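/- **Theorem 1.6.** Let $n\ge 1$ and let $\mathcal L=-\Delta_z+\frac14|z|^2-i\sum_{j=1}^n\left(x_j\partial_{y_j}-y_j\partial_{x_j}\right)$, $z=x+iy\in\mathbb C^n$, be the special Hermite operator on $L^2(\mathbb C^n)$. Its eigenvalues are $2k+n$, $k=0,1,2,\dots$; let $Q_k$ be the orthogonal projection of $L^2(\mathbb C^n)$ onto the $L^2$ eigenspace for $2k+n$, and let $e^{-it\mathcal L}f=\sum_{k\ge0}e^{-it(2k+n)}Q_kf$. (a) Let $q=\frac{2n+1}{2n-1}$, $\frac1p+\frac nq=n$ (that is, $p=\frac{2n+1}{2n}$) and $\beta=\frac{2q}{q+1}$. Then there is no constant $C$ such that $$\Big\|\sum_{j} n_j\,\big|e^{-it\mathcal L}f_j\big|^2\Big\|_{L^p((-\pi,\pi),L^q(\mathbb C^n))}\le C\Big(\sum_{j}|n_j|^\beta\Big)^{1/\beta}$$ for all finite orthonormal systems $(f_j)_j$ in $L^2(\mathbb C^n)$ and all $(n_j)_j\subset\mathbb C$. In particular, the estimate fails for general orthonormal systems. (b) There is a measurable function $V\ge0$ on $\mathbb R\times\mathbb C^n$,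 not almost everywhere zero on $(-\pi,\pi)\times\mathbb C^n$, with $V\in L^{2n+1}((-\pi,\pi),L^{\frac{2n+1}{2}}(\mathbb C^n))$, such that the integral $$B_V=\int_{-\pi}^{\pi}e^{it\mathcal L}\,V(t,\cdot)\,e^{-it\mathcal L}\,dt,\qquad \langle f,B_Vg\rangle=\int_{-\pi}^{\pi}\int_{\mathbb C^n}\overline{e^{-it\mathcal L}f(z)}\,V(t,z)\,e^{-it\mathcal L}g(z)\,dz\,dt\quad(f,g\in L^2(\mathbb C^n)),$$ converges weakly and defines a bounded positive operator on $L^2(\mathbb C^n)$, and $$\operatorname{Tr}\big(B_V^{\,2n+1}\big)=\infty .$$ -/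

import Mathlib

open MeasureTheory Set
open scoped ENNReal ComplexConjugate SchwartzMap InnerProductSpace

noncomputable section

namespace SpecialHermite

/-- The Hilbert space `L²(ℂⁿ)` with respect to Lebesgue measure on `ℂⁿ = ℝ²ⁿ`. -/
abbrev L2 (n : ℕ) : Type := Lp ℂ 2 (volume : Measure (Fin n → ℂ))

/-- The partial derivative `∂φ/∂x_j`, where `z = x + i y ∈ ℂⁿ`. -/
def partialX {n : ℕ} (j : Fin n) (φ : (Fin n → ℂ) → ℂ) (z : Fin n → ℂ) : ℂ :=
  fderiv ℝ φ z (Pi.single j 1)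

/-- The partial derivative `∂φ/∂y_j`, where `z = x + i y ∈ ℂⁿ`. -/
def partialY {n : ℕ} (j : Fin n) (φ : (Fin n → ℂ) → ℂ) (z : Fin n → ℂ) : ℂ :=
  fderiv ℝ φ z (Pi.single j Complex.I)

/-- The special Hermite operator (twisted Laplacian)
`𝓛 = -Δ_z + |z|²/4 - i ∑_j (x_j ∂/∂y_j - y_j ∂/∂x_j)` as a differential expression. -/
def twistedLaplacian {n : ℕ} (φ : (Fin n → ℂ) → ℂ) (z : Fin n → ℂ) : ℂ :=
  -(∑ j, (partialX j (partialX j φ) z + partialY j (partialY j φ) z))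
    + (1 / 4 : ℂ) * ((∑ j, ‖z j‖ ^ 2 : ℝ) : ℂ) * φ z
    - Complex.I * ∑ j, (((z j).re : ℂ) * partialY j φ z - ((z j).im : ℂ) * partialX j φ z)

/-- The `L²` eigenspace of `𝓛` for the real number `lam`: all `f ∈ L²(ℂⁿ)` with `𝓛 f = lam f` in the
sense of distributions, that is `⟪𝓛 φ - lam φ, f⟫ = 0` for all Schwartz functions `φ`
(the expression `𝓛` is formally self-adjoint). It is a closed subspace of `L²(ℂⁿ)`. -/
def eigenspace (n : ℕ) (lam : ℝ) : Submodule ℂ (L2 n) :=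
  (Submodule.span ℂ {g : L2 n | ∃ φ : 𝓢(Fin n → ℂ, ℂ),
    (g : (Fin n → ℂ) → ℂ) =ᵐ[volume] fun z => twistedLaplacian φ z - (lam : ℂ) * φ z})ᗮ

instance eigenspace_hasOrthogonalProjection (n : ℕ) (lam : ℝ) :
    (eigenspace n lam).HasOrthogonalProjection := by
  unfold eigenspace
  infer_instance

/-- The spectral projection `Q_k`: the orthogonal projection of `L²(ℂⁿ)` onto the eigenspace of
`𝓛` for its `k`-th eigenvalue `2k + n`. -/
def spectralProj (n k : ℕ) : L2 n →L[ℂ] L2 n :=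
  (eigenspace n (2 * k + n)).starProjection

/-- The Schrödinger propagator `e^{-it𝓛} f = ∑_k e^{-it(2k+n)} Q_k f` on `L²(ℂⁿ)`. -/
def propagator (n : ℕ) (t : ℝ) (f : L2 n) : L2 n :=
  ∑' k : ℕ, Complex.exp (-Complex.I * t * (2 * k + n)) • spectralProj n k f

/-- The mixed norm of `L^p((-π, π), L^q(ℂⁿ))`. -/
def mixedNorm {n : ℕ} {E : Type*} [NormedAddCommGroup E] (p q : ℝ)
    (F : ℝ → (Fin n → ℂ) → E) : ℝ≥0∞ :=
  (∫⁻ t in Ioo (-Real.pi) Real.pi, eLpNorm (F t) (ENNReal.ofReal q) volume ^ p) ^ (1 / p)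

/-- The orthonormal Strichartz estimate
`‖∑_j n_j |e^{-it𝓛} f_j|²‖_{L^p((-π,π), L^q(ℂⁿ))} ≤ C (∑_j |n_j|^β)^{1/β}`
with one constant `C` for all finite orthonormal systems `(f_j)` in `L²(ℂⁿ)` and all
complex coefficients `(n_j)`. -/
def OrthonormalStrichartz (n : ℕ) (p q β : ℝ) : Prop :=
  ∃ C : ℝ, ∀ (N : ℕ) (f : Fin N → L2 n), Orthonormal ℂ f → ∀ a : Fin N → ℂ,
    mixedNorm p q (fun t z => ∑ j, a j * ((‖propagator n t (f j) z‖ ^ 2 : ℝ) : ℂ))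
      ≤ ENNReal.ofReal (C * (∑ j, ‖a j‖ ^ β) ^ (1 / β))

/-- `B` is the bounded operator `∫_{-π}^{π} e^{it𝓛} V(t, ·) e^{-it𝓛} dt` on `L²(ℂⁿ)`, the integral
being understood weakly: `⟪f, B g⟫ = ∫_{-π}^{π} ∫ conj(e^{-it𝓛} f) V(t, ·) (e^{-it𝓛} g) dz dt` for all
`f` and `g`, where both integrals converge. -/
def IsTimeAverage {n : ℕ} (V : ℝ → (Fin n → ℂ) → ℝ) (B : L2 n →L[ℂ] L2 n) : Prop :=
  ∀ f g : L2 n,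
    (∀ᵐ t ∂(volume.restrict (Ioo (-Real.pi) Real.pi)),
      Integrable (fun z => conj (propagator n t f z) * (V t z : ℂ) * propagator n t g z) volume) ∧
    IntegrableOn
      (fun t => ∫ z, conj (propagator n t f z) * (V t z : ℂ) * propagator n t g z)
      (Ioo (-Real.pi) Real.pi) volume ∧
    ⟪f, B g⟫_ℂ = ∫ t in Ioo (-Real.pi) Real.pi, ∫ z,
      conj (propagator n t f z) * (V t z : ℂ) * propagator n t g z

/-- The trace `∑_i ⟪b_i, T b_i⟫ ∈ [0, ∞]` of a positive operator `T`, computed in the Hilbert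
basis `b`. -/
def traceIn {n : ℕ} {ι : Type} (b : HilbertBasis ι ℂ (L2 n)) (T : L2 n →L[ℂ] L2 n) : ℝ≥0∞ :=
  ∑' i, ENNReal.ofReal (RCLike.re ⟪b i, T (b i)⟫_ℂ)

end SpecialHermite

end

/-! Take `V(t, z) = v(z) = exp(-|z|²/2)`, independent of time. On an eigenspace `e^{-it𝓛}` is
multiplication by a phase, so for an eigenfunction `f` the density `|e^{-it𝓛} f|²` equals `|f|²` at
all times, and `⟨f, B_V f⟩ = 2π ⟨f, v f⟩`. Both parts then follow from `exists_large_system`: there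
are finite orthonormal systems of eigenfunctions for which `S = ∑ λ_j^(2n+1)`, with `λ_j = ⟨f_j, v
f_j⟩`, is as large as desired.

The systems come from the special Hermite functions `Φ_{α,β}`, a Hilbert basis of `L²(ℂⁿ)` with
eigenvalues `2|β| + n`. The matrix elements of `v` in this basis are Gaussian integrals with closed
binomial formulas. Fix a block `|α| = l`, `|β| = k`; let `D` be the number of `N ∈ ℕⁿ` with `|N| = k
+ l`, and `μ = 2^(-n-k-l) (k+l choose k)`. Vandermonde's identity shows that `v` compressed to the
block has trace `Dμ` (`sum_block_diagonal`) and squared Hilbert–Schmidt norm at least `Dμ²`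
(`le_sum_block_sq`). Diagonalizing the block and applying Bernoulli's inequality yields `∑ λ^(m+1) ≥
D μ^(m+1)` (`mul_sum_le_sum_pow`). For `k = r - i`, `l = r + i` with `2i² ≤ r`, one has `μ ≳
r^(-1/2)` and `D ≳ r^(n-1)`; the roughly `√r` such blocks contribute `≳ r^(1/2 + (n-1) - (2n+1)/2) =
1/r`, and the harmonic series diverges.

For (a), the weights `n_j = λ_j^(2n)` and Hölder's inequality against `v` would give `S ≤ ‖v‖ C
S^(2n/(2n+1))`, hence a bound on `S`. For (b), the trace of `B^(2n+1)` dominates `∑ ⟨f_j, B^(2n+1)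
f_j⟩`, which by Jensen's inequality is at least `∑ ⟨f_j, B f_j⟩^(2n+1) ≥ S`. -/

noncomputable section

namespace SpecialHermite

/-! ### Gaussians as Schwartz functions -/

section GaussianSchwartz

variable {E : Type*} [NormedAddCommGroup E] [NormedSpace ℝ E]

theorem exists_pow_mul_exp_neg_sq_le (N : ℕ) {c : ℝ} (hc : 0 < c) :
    ∃ C : ℝ, ∀ r : ℝ, 0 ≤ r → (1 + r) ^ N * Real.exp (-(c * r ^ 2)) ≤ C := by
  obtain ⟨a, ha⟩ : ∃ a : ℝ, a = 1 + 1 / c := ⟨_, rfl⟩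
  have hapos : 0 < a := by rw [ha]; positivity
  refine ⟨N.factorial * Real.exp (1 + (N + 1) ^ 2 / c), fun r hr => ?_⟩
  have h1 : (1 + r) ^ N ≤ N.factorial * Real.exp (1 + r) := by
    have := Real.pow_div_factorial_le_exp (x := 1 + r) (by positivity) N
    rw [div_le_iff₀ (by positivity)] at this
    linarith
  have h2 : r - c * r ^ 2 ≤ (N + 1) ^ 2 / c := by
    have : r - c * r ^ 2 ≤ 1 / c := by
      rw [le_div_iff₀ hc]
      nlinarith [sq_nonneg (c * r - 1), mul_nonneg hc.le hr]
    refine this.trans ?_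
    gcongr
    have : (0 : ℝ) ≤ N := by positivity
    nlinarith
  calc (1 + r) ^ N * Real.exp (-(c * r ^ 2))
      ≤ N.factorial * Real.exp (1 + r) * Real.exp (-(c * r ^ 2)) := by gcongr
    _ = N.factorial * Real.exp (1 + (r - c * r ^ 2)) := by
        rw [mul_assoc, ← Real.exp_add]; ring_nf
    _ ≤ _ := by gcongr

/-- The Schwartz function `exp(-q)` for a temperate function `q` that dominates a multiple of
the squared norm. -/
def expNeg (q : E → ℝ) (hq : q.HasTemperateGrowth) {c : ℝ} (hc : 0 < c)
    (h : ∀ x, c * ‖x‖ ^ 2 ≤ q x) : 𝓢(E, ℂ) where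
  toFun x := (Real.exp (-q x) : ℂ)
  smooth' := by
    have := hq.1
    exact Complex.ofRealCLM.contDiff.comp (Real.contDiff_exp.comp this.neg)
  decay' := by
    intro k n
    obtain ⟨m, C, hC0, hC⟩ := hq.neg.norm_iteratedFDeriv_le_uniform n
    obtain ⟨C', hC'⟩ := exists_pow_mul_exp_neg_sq_le (k + m * n) hc
    refine ⟨n.factorial * (C + 1) ^ n * C', fun x => ?_⟩
    -- Faà di Bruno bound: every derivative of `exp` at `-q x` is `exp (-q x)`, and the `i`-th
    -- derivative of `q` is at most `D ^ i` with `D = (C + 1)(1 + ‖x‖)^m`. The `+ 1` ensures `D ≥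
    -- 1`, hence `D ≤ D ^ i`.
    have key : ‖iteratedFDeriv ℝ n (Real.exp ∘ (-q)) x‖
        ≤ n.factorial * Real.exp (-q x) * ((C + 1) * (1 + ‖x‖) ^ m) ^ n := by
      apply norm_iteratedFDeriv_comp_le (N := (⊤ : ℕ∞)) Real.contDiff_exp hq.neg.1
        (by exact_mod_cast le_top)
      · intro i _
        rw [norm_iteratedFDeriv_eq_norm_iteratedDeriv, iteratedDeriv_eq_iterate, Real.iter_deriv_exp]
        simp
      · intro i hi hin
        refine (hC i hin x).trans ?_
        have h1 : 1 ≤ (C + 1) * (1 + ‖x‖) ^ m :=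
          one_le_mul_of_one_le_of_one_le (by linarith) (one_le_pow₀ (by simp))
        refine le_trans ?_ (le_self_pow₀ h1 (by lia))
        gcongr
        linarith
    have e : (fun x => (Real.exp (-q x) : ℂ)) = Complex.ofRealLI ∘ (Real.exp ∘ (-q)) := rfl
    rw [e, Complex.ofRealLI.norm_iteratedFDeriv_comp_left (n := (⊤ : ℕ∞))
      ((Real.contDiff_exp.comp hq.neg.1).contDiffAt) (by exact_mod_cast le_top)]
    calc ‖x‖ ^ k * ‖iteratedFDeriv ℝ n (Real.exp ∘ (-q)) x‖
        ≤ (1 + ‖x‖) ^ k * (n.factorial * Real.exp (-(c * ‖x‖ ^ 2))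
            * ((C + 1) * (1 + ‖x‖) ^ m) ^ n) := by
          gcongr
          · linarith
          · refine key.trans ?_
            gcongr
            exact h x
      _ = n.factorial * (C + 1) ^ n * ((1 + ‖x‖) ^ (k + m * n) * Real.exp (-(c * ‖x‖ ^ 2))) := by
          rw [mul_pow, ← pow_mul, pow_add]; ring
      _ ≤ _ := by
          gcongr
          exact hC' _ (norm_nonneg x)

end GaussianSchwartz

/-! ### Wirtinger calculus: `wirt p q` encodes `∂f/∂z = p`, `∂f/∂z̄ = q` -/

section Wirtinger

/-- The real-linear map `w ↦ p w + q conj w`. -/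
def wirt (p q : ℂ) : ℂ →L[ℝ] ℂ :=
  p • ContinuousLinearMap.id ℝ ℂ + q • (Complex.conjCLE : ℂ →L[ℝ] ℂ)

theorem wirt_apply (p q w : ℂ) : wirt p q w = p * w + q * conj w := rfl

theorem hasFDerivAt_mul_wirt {f g : ℂ → ℂ} {p q p' q' z : ℂ} (hf : HasFDerivAt f (wirt p q) z)
    (hg : HasFDerivAt g (wirt p' q') z) :
    HasFDerivAt (fun z => f z * g z) (wirt (p * g z + f z * p') (q * g z + f z * q')) z := by
  refine (hf.fun_mul hg).congr_fderiv (ContinuousLinearMap.ext fun w => ?_)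
  simp [wirt_apply]; ring

theorem hasFDerivAt_add_wirt {f g : ℂ → ℂ} {p q p' q' z : ℂ} (hf : HasFDerivAt f (wirt p q) z)
    (hg : HasFDerivAt g (wirt p' q') z) :
    HasFDerivAt (fun z => f z + g z) (wirt (p + p') (q + q')) z := by
  refine (hf.fun_add hg).congr_fderiv (ContinuousLinearMap.ext fun w => ?_)
  simp [wirt_apply]; ring

theorem hasFDerivAt_const_mul_wirt {f : ℂ → ℂ} {p q z : ℂ} (c : ℂ) (hf : HasFDerivAt f (wirt p q) z) :
    HasFDerivAt (fun z => c * f z) (wirt (c * p) (c * q)) z := by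
  refine (hf.const_mul c).congr_fderiv (ContinuousLinearMap.ext fun w => ?_)
  simp [wirt_apply]; ring

theorem hasFDerivAt_id_wirt (z : ℂ) : HasFDerivAt (fun z : ℂ => z) (wirt 1 0) z := by
  refine (hasFDerivAt_id z).congr_fderiv (ContinuousLinearMap.ext fun w => ?_)
  simp [wirt_apply]

theorem hasFDerivAt_conj_wirt (z : ℂ) : HasFDerivAt (fun z : ℂ => conj z) (wirt 0 1) z := by
  refine ((Complex.conjCLE : ℂ →L[ℝ] ℂ).hasFDerivAt (x := z)).congr_fderiv
    (ContinuousLinearMap.ext fun w => ?_)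
  simp [wirt_apply]

theorem hasFDerivAt_gauss_wirt (c : ℝ) (z : ℂ) :
    HasFDerivAt (fun z : ℂ => (Real.exp (-(c * ‖z‖ ^ 2)) : ℂ))
      (wirt (-(c * conj z) * Real.exp (-(c * ‖z‖ ^ 2))) (-(c * z) * Real.exp (-(c * ‖z‖ ^ 2)))) z := by
  have e : (fun z : ℂ => (Real.exp (-(c * ‖z‖ ^ 2)) : ℂ))
      = fun z => Complex.exp (-(c : ℂ) * (z * conj z)) := by
    funext z
    rw [Complex.mul_conj']; push_cast; ring_nf
  have e' : (Real.exp (-(c * ‖z‖ ^ 2)) : ℂ) = Complex.exp (-(c : ℂ) * (z * conj z)) := congrFun e z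
  rw [e', e]
  have h := (hasFDerivAt_const_mul_wirt (-(c : ℂ))
    (hasFDerivAt_mul_wirt (hasFDerivAt_id_wirt z) (hasFDerivAt_conj_wirt z))).cexp
  refine h.congr_fderiv (ContinuousLinearMap.ext fun w => ?_)
  simp [wirt_apply]; ring

end Wirtinger

/-! ### Complex Hermite polynomials -/

section ComplexHermite

/-- The complex Hermite polynomials `∂_τ^b ∂_s^a exp(τ z + s conj z - 2 τ s)` at `τ = s = 0`. -/
def chPoly (a b : ℕ) (z : ℂ) : ℂ :=
  match b with
  | 0 => conj z ^ a
  | b + 1 => z * chPoly a b z - 2 * a * chPoly (a - 1) b z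

theorem chPoly_zero_right (a : ℕ) (z : ℂ) : chPoly a 0 z = conj z ^ a := rfl

theorem chPoly_succ_right (a b : ℕ) (z : ℂ) :
    chPoly a (b + 1) z = z * chPoly a b z - 2 * a * chPoly (a - 1) b z := rfl

theorem mul_chPoly (a b : ℕ) (z : ℂ) :
    z * chPoly a b z = chPoly a (b + 1) z + 2 * a * chPoly (a - 1) b z := by
  rw [chPoly_succ_right]; ring

/-- The generating function is symmetric under exchanging `(z, τ)` with `(z̄, s)`, but the recursive
definition singles out `z`; this relation and `conj_chPoly` restore the symmetry. Truncated indices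
such as `a - 1` at `a = 0` are harmless, being multiplied by `a`. -/
theorem conj_mul_chPoly (a b : ℕ) (z : ℂ) :
    conj z * chPoly a b z = chPoly (a + 1) b z + 2 * b * chPoly a (b - 1) z := by
  induction b generalizing a with
  | zero => simp [chPoly_zero_right]; ring
  | succ b ih =>
    rw [chPoly_succ_right, chPoly_succ_right, Nat.add_sub_cancel, Nat.add_sub_cancel, mul_sub]
    have h1 : conj z * (z * chPoly a b z)
        = z * (chPoly (a + 1) b z + 2 * b * chPoly a (b - 1) z) := by rw [← ih]; ring
    rw [h1]
    have h2 : conj z * (2 * a * chPoly (a - 1) b z)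
        = 2 * a * (chPoly a b z + 2 * b * chPoly (a - 1) (b - 1) z) := by
      rcases a with _ | a
      · simp
      · have := ih a
        simp only [Nat.add_sub_cancel]
        rw [← this]; ring
    rw [h2]
    rcases b with _ | b
    · push_cast; ring
    · have h3 := chPoly_succ_right a b z
      simp only [Nat.add_sub_cancel]
      push_cast
      linear_combination 2 * ((b : ℂ) + 1) * (-h3)

theorem conj_chPoly (a b : ℕ) (z : ℂ) : conj (chPoly a b z) = chPoly b a z := by
  induction b generalizing a with
  | zero =>
    rw [chPoly_zero_right, map_pow, Complex.conj_conj]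
    induction a with
    | zero => simp [chPoly_zero_right]
    | succ a iha => rw [pow_succ, iha, chPoly_succ_right]; push_cast; ring
  | succ b ih =>
    rw [chPoly_succ_right, map_sub, map_mul, map_mul, map_mul, ih, ih]
    have h := conj_mul_chPoly b a z
    rw [h, map_ofNat, Complex.conj_natCast]
    ring

/-- Differentiating the generating function in `z` or `z̄` multiplies it by `τ` or `s`, so
derivatives lower one index. -/
theorem hasFDerivAt_chPoly (a b : ℕ) (z : ℂ) :
    HasFDerivAt (chPoly a b) (wirt (b * chPoly a (b - 1) z) (a * chPoly (a - 1) b z)) z := by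
  induction b generalizing a with
  | zero =>
    have e : chPoly a 0 = fun z => conj z ^ a := rfl
    rw [e]
    have h := (hasFDerivAt_conj_wirt z).pow a
    refine h.congr_fderiv (ContinuousLinearMap.ext fun w => ?_)
    simp [wirt_apply, chPoly_zero_right]
  | succ b ih =>
    have e : chPoly a (b + 1) = fun z => z * chPoly a b z + (-2 * a) * chPoly (a - 1) b z := by
      funext z; rw [chPoly_succ_right]; ring
    rw [e]
    have h := hasFDerivAt_add_wirt (hasFDerivAt_mul_wirt (hasFDerivAt_id_wirt z) (ih a))
      (hasFDerivAt_const_mul_wirt (-2 * a : ℂ) (ih (a - 1)))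
    convert h using 2
    · rw [Nat.add_sub_cancel]
      rcases b with _ | b
      · simp
      · have h3 := chPoly_succ_right a b z
        simp only [Nat.add_sub_cancel]
        push_cast
        linear_combination ((b : ℂ) + 1) * h3
    · rw [chPoly_succ_right]
      rcases a with _ | a
      · simp
      · simp only [Nat.add_sub_cancel]
        push_cast
        ring

theorem hasTemperateGrowth_conj : Function.HasTemperateGrowth (fun z : ℂ => conj z) :=
  (Complex.conjCLE : ℂ →L[ℝ] ℂ).hasTemperateGrowth

theorem hasTemperateGrowth_chPoly (a b : ℕ) : (chPoly a b).HasTemperateGrowth := by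
  induction b generalizing a with
  | zero => exact hasTemperateGrowth_conj.pow a
  | succ b ih =>
    exact (Function.HasTemperateGrowth.id'.mul (ih a)).sub
      ((Function.HasTemperateGrowth.const _).mul (ih (a - 1)))

end ComplexHermite

/-! ### Gaussian integrals of products of complex Hermite polynomials -/

section GaussianIntegrals

theorem hasTemperateGrowth_const_mul_norm_sq (c : ℝ) :
    Function.HasTemperateGrowth (fun z : ℂ => c * ‖z‖ ^ 2) :=
  (Function.HasTemperateGrowth.const c).mul (Function.hasTemperateGrowth_norm_sq ℂ)

/-- The Gaussian `exp(-c|z|²)` on `ℂ` as a Schwartz function. -/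
def gauss (c : ℝ) (hc : 0 < c) : 𝓢(ℂ, ℂ) :=
  expNeg (fun z : ℂ => c * ‖z‖ ^ 2) (hasTemperateGrowth_const_mul_norm_sq c) hc fun _ => le_rfl

theorem gauss_apply (c : ℝ) (hc : 0 < c) (z : ℂ) :
    gauss c hc z = (Real.exp (-(c * ‖z‖ ^ 2)) : ℂ) := rfl

theorem integrable_mul_gauss {P : ℂ → ℂ} (hP : P.HasTemperateGrowth) {c : ℝ} (hc : 0 < c) :
    Integrable (fun z : ℂ => P z * (Real.exp (-(c * ‖z‖ ^ 2)) : ℂ)) := by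
  have := (SchwartzMap.smulLeftCLM ℂ P (gauss c hc)).integrable (μ := volume)
  refine this.congr (Filter.Eventually.of_forall fun z => ?_)
  simp only [SchwartzMap.smulLeftCLM_apply_apply hP, smul_eq_mul, gauss_apply]

/-- Gaussian integration by parts for `∂/∂ conj z`. -/
theorem integral_mul_gauss {P p q : ℂ → ℂ} (hP : P.HasTemperateGrowth)
    (hp : p.HasTemperateGrowth) (hq : q.HasTemperateGrowth)
    (hd : ∀ z, HasFDerivAt P (wirt (p z) (q z)) z) {c : ℝ} (hc : 0 < c) :
    c * ∫ z : ℂ, z * P z * (Real.exp (-(c * ‖z‖ ^ 2)) : ℂ)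
      = ∫ z : ℂ, q z * (Real.exp (-(c * ‖z‖ ^ 2)) : ℂ) := by
  have hiz : Integrable (fun z : ℂ => z * P z * (Real.exp (-(c * ‖z‖ ^ 2)) : ℂ)) :=
    integrable_mul_gauss (Function.HasTemperateGrowth.id'.mul hP) hc
  have hicz : Integrable (fun z : ℂ => conj z * P z * (Real.exp (-(c * ‖z‖ ^ 2)) : ℂ)) :=
    integrable_mul_gauss (hasTemperateGrowth_conj.mul hP) hc
  have hip := integrable_mul_gauss hp hc
  have hiq := integrable_mul_gauss hq hc
  have c2 : 0 < c / 2 := by positivity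
  have e2 : ∀ z : ℂ, (Real.exp (-(c / 2 * ‖z‖ ^ 2)) : ℂ) * (Real.exp (-(c / 2 * ‖z‖ ^ 2)) : ℂ)
      = (Real.exp (-(c * ‖z‖ ^ 2)) : ℂ) := fun z => by
    rw [← Complex.ofReal_mul, ← Real.exp_add]; ring_nf
  -- Integration by parts in the real direction `v`. The Gaussian is split into two equal halves so
  -- that both factors are Schwartz.
  have key : ∀ v : ℂ,
      ∫ z : ℂ, (p z * v + q z * conj v - c * (conj z * v + z * conj v) * P z)
        * (Real.exp (-(c * ‖z‖ ^ 2)) : ℂ) = 0 := by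
    intro v
    have h := SchwartzMap.integral_mul_lineDerivOp_right_eq_neg_left (μ := volume)
      (SchwartzMap.smulLeftCLM ℂ P (gauss (c / 2) c2)) (gauss (c / 2) c2) v
    have d1 : ∀ z, HasFDerivAt (gauss (c / 2) c2) _ z := fun z => hasFDerivAt_gauss_wirt (c / 2) z
    have d2 : ∀ z, HasFDerivAt (SchwartzMap.smulLeftCLM ℂ P (gauss (c / 2) c2)) _ z := fun z => by
      have := hasFDerivAt_mul_wirt (hd z) (d1 z)
      refine this.congr_of_eventuallyEq (Filter.Eventually.of_forall fun z => ?_)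
      simp only [SchwartzMap.smulLeftCLM_apply_apply hP, smul_eq_mul]
    rw [← sub_eq_zero, sub_neg_eq_add, ← integral_add] at h
    · rw [← h]
      refine integral_congr_ae (Filter.Eventually.of_forall fun z => ?_)
      simp only [SchwartzMap.lineDerivOp_apply_eq_fderiv, (d1 z).fderiv, (d2 z).fderiv, wirt_apply,
        SchwartzMap.smulLeftCLM_apply_apply hP, smul_eq_mul, gauss_apply]
      rw [← e2 z]
      push_cast
      ring
    · exact (SchwartzMap.pairing (ContinuousLinearMap.mul ℂ ℂ) _ _).integrable
    · exact (SchwartzMap.pairing (ContinuousLinearMap.mul ℂ ℂ) _ _).integrable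
  have h1 := key 1
  have hI := key Complex.I
  have h3 : ∫ z : ℂ, (q z - c * z * P z) * (Real.exp (-(c * ‖z‖ ^ 2)) : ℂ) = 0 := by
    have i1 : ∀ v : ℂ, Integrable fun z : ℂ =>
        (p z * v + q z * conj v - c * (conj z * v + z * conj v) * P z)
        * (Real.exp (-(c * ‖z‖ ^ 2)) : ℂ) := fun v => by
      have := ((hip.const_mul v).add (hiq.const_mul (conj v))).sub
        ((hicz.const_mul (c * v)).add (hiz.const_mul (c * conj v)))
      refine this.congr (Filter.Eventually.of_forall fun z => ?_)
      simp only [Pi.add_apply, Pi.sub_apply]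
      ring
    -- Since `∂_x + i ∂_y = 2 ∂/∂z̄`, the identity for `v = 1` plus `i` times that for `v = i`
    -- eliminates `p`.
    have h4 : (∫ z : ℂ, (p z * 1 + q z * conj 1 - c * (conj z * 1 + z * conj 1) * P z)
        * (Real.exp (-(c * ‖z‖ ^ 2)) : ℂ)) + Complex.I * ∫ z : ℂ, (p z * Complex.I +
        q z * conj Complex.I - c * (conj z * Complex.I + z * conj Complex.I) * P z)
        * (Real.exp (-(c * ‖z‖ ^ 2)) : ℂ) = 0 := by rw [h1, hI]; simp
    rw [← integral_const_mul, ← integral_add (i1 1) ((i1 Complex.I).const_mul _)] at h4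
    have h5 : ∫ z : ℂ, 2 * ((q z - c * z * P z) * (Real.exp (-(c * ‖z‖ ^ 2)) : ℂ)) = 0 := by
      rw [← h4]
      refine integral_congr_ae (Filter.Eventually.of_forall fun z => ?_)
      simp only [map_one, Complex.conj_I]
      linear_combination ((p z - q z - c * (conj z - z) * P z)
        * (Real.exp (-(c * ‖z‖ ^ 2)) : ℂ)) * (-Complex.I_mul_I)
    rw [integral_const_mul] at h5
    simpa using h5
  rw [← integral_const_mul, eq_comm, ← sub_eq_zero, ← integral_sub hiq (hiz.const_mul _), ← h3]
  refine integral_congr_ae (Filter.Eventually.of_forall fun z => ?_)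
  simp only
  ring

/-- The Gaussian integrals `∫ K_{a,b} K_{c,d} exp(-r|z|²)` of products of complex Hermite
polynomials. -/
def chInt (r : ℝ) (a b c d : ℕ) : ℂ :=
  ∫ z : ℂ, chPoly a b z * chPoly c d z * (Real.exp (-(r * ‖z‖ ^ 2)) : ℂ)

theorem integrable_chInt {r : ℝ} (hr : 0 < r) (a b c d : ℕ) :
    Integrable fun z : ℂ => chPoly a b z * chPoly c d z * (Real.exp (-(r * ‖z‖ ^ 2)) : ℂ) :=
  integrable_mul_gauss ((hasTemperateGrowth_chPoly a b).mul (hasTemperateGrowth_chPoly c d)) hr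

theorem chInt_comm (r : ℝ) (a b c d : ℕ) : chInt r a b c d = chInt r c d a b := by
  unfold chInt; congr 1; funext z; ring

theorem chInt_conj (r : ℝ) (a b c d : ℕ) : conj (chInt r a b c d) = chInt r b a d c := by
  unfold chInt
  rw [← integral_conj]
  congr 1; funext z
  rw [map_mul, map_mul, conj_chPoly, conj_chPoly, Complex.conj_ofReal]

/-- Write `z K_{c,d} = K_{c,d+1} + 2c K_{c-1,d}` and integrate by parts. The coefficient `1 - 2r`
vanishes at `r = 1/2`, which is the source of orthogonality, and is `-1` at `r = 1`, the case of the
potential. -/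
theorem chInt_succ {r : ℝ} (hr : 0 < r) (a b c d : ℕ) :
    r * chInt r a b c (d + 1) = a * chInt r (a - 1) b c d
      + (1 - 2 * r) * c * chInt r a b (c - 1) d := by
  have hP := (hasTemperateGrowth_chPoly a b).mul (hasTemperateGrowth_chPoly c d)
  have h := integral_mul_gauss (P := fun z => chPoly a b z * chPoly c d z)
    (p := fun z => (b * chPoly a (b - 1) z) * chPoly c d z
      + chPoly a b z * (d * chPoly c (d - 1) z))
    (q := fun z => (a * chPoly (a - 1) b z) * chPoly c d z
      + chPoly a b z * (c * chPoly (c - 1) d z)) hP ?_ ?_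
    (fun z => hasFDerivAt_mul_wirt (hasFDerivAt_chPoly a b z) (hasFDerivAt_chPoly c d z)) hr
  · have e1 : ∫ z : ℂ, z * (chPoly a b z * chPoly c d z) * (Real.exp (-(r * ‖z‖ ^ 2)) : ℂ)
        = chInt r a b c (d + 1) + 2 * c * chInt r a b (c - 1) d := by
      unfold chInt
      rw [← integral_const_mul, ← integral_add (integrable_chInt hr _ _ _ _)
        ((integrable_chInt hr _ _ _ _).const_mul _)]
      congr 1; funext z
      have := mul_chPoly c d z
      linear_combination (chPoly a b z * (Real.exp (-(r * ‖z‖ ^ 2)) : ℂ)) * this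
    have e2 : ∫ z : ℂ, ((a * chPoly (a - 1) b z) * chPoly c d z
        + chPoly a b z * (c * chPoly (c - 1) d z)) * (Real.exp (-(r * ‖z‖ ^ 2)) : ℂ)
        = a * chInt r (a - 1) b c d + c * chInt r a b (c - 1) d := by
      unfold chInt
      rw [← integral_const_mul, ← integral_const_mul,
        ← integral_add ((integrable_chInt hr _ _ _ _).const_mul _)
        ((integrable_chInt hr _ _ _ _).const_mul _)]
      congr 1; funext z; ring
    rw [e1, e2] at h
    linear_combination h
  · exact (((Function.HasTemperateGrowth.const _).mul (hasTemperateGrowth_chPoly _ _)).mul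
      (hasTemperateGrowth_chPoly _ _)).add ((hasTemperateGrowth_chPoly _ _).mul
      ((Function.HasTemperateGrowth.const _).mul (hasTemperateGrowth_chPoly _ _)))
  · exact (((Function.HasTemperateGrowth.const _).mul (hasTemperateGrowth_chPoly _ _)).mul
      (hasTemperateGrowth_chPoly _ _)).add ((hasTemperateGrowth_chPoly _ _).mul
      ((Function.HasTemperateGrowth.const _).mul (hasTemperateGrowth_chPoly _ _)))

theorem chInt_zero {r : ℝ} (hr : 0 < r) : chInt r 0 0 0 0 = Real.pi / r := by
  have h := GaussianFourier.integral_cexp_neg_mul_sq_norm (V := ℂ) (b := (r : ℂ)) (by simpa using hr)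
  simp only [Complex.finrank_real_complex] at h
  norm_num at h
  rw [← h]
  unfold chInt
  congr 1; funext z
  simp [chPoly_zero_right]

theorem chInt_left_zero {r : ℝ} (hr : 0 < r) (a c : ℕ) :
    chInt r 0 a 0 c = if a = 0 ∧ c = 0 then (Real.pi / r : ℂ) else 0 := by
  have hr' : (r : ℂ) ≠ 0 := by exact_mod_cast hr.ne'
  have key : ∀ a c, chInt r 0 a 0 (c + 1) = 0 := fun a c => by
    have := chInt_succ hr 0 a 0 c
    simpa [hr'] using this
  rcases c with _ | c
  · rcases a with _ | a
    · simp [chInt_zero hr]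
    · rw [chInt_comm, key]; simp
  · rw [key]; simp

/-- The recursion lowers `d` to `0`; the symmetry between the two factors then lets it lower `b`.
What remains are the integrals of powers of `z̄`, so any closed formula is checked on these data
alone. -/
theorem chInt_eq_of_recursion {r : ℝ} (hr : 0 < r) (F : ℕ → ℕ → ℕ → ℕ → ℂ)
    (h0 : ∀ a c, F a 0 c 0 = if a = 0 ∧ c = 0 then (Real.pi / r : ℂ) else 0)
    (hcomm : ∀ a b c d, F a b c d = F c d a b)
    (hrec : ∀ a b c d, r * F a b c (d + 1) = a * F (a - 1) b c d + (1 - 2 * r) * c * F a b (c - 1) d)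
    (a b c d : ℕ) : chInt r a b c d = F a b c d := by
  have hr' : (r : ℂ) ≠ 0 := by exact_mod_cast hr.ne'
  induction d generalizing a b c with
  | succ d ih =>
    apply mul_left_cancel₀ hr'
    rw [chInt_succ hr, hrec, ih, ih]
  | zero =>
    induction b generalizing a c with
    | succ b ih =>
      rw [chInt_comm, hcomm]
      apply mul_left_cancel₀ hr'
      rw [chInt_succ hr, hrec, chInt_comm, ih, chInt_comm r c, ih, hcomm (c - 1), hcomm c]
    | zero =>
      have h := congrArg conj (chInt_left_zero hr a c)
      rw [chInt_conj] at h
      rw [h, h0]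
      split_ifs <;> simp

theorem chInt_half (a b c d : ℕ) :
    chInt (1 / 2) a b c d
      = if a = d ∧ b = c then (2 * Real.pi * 2 ^ (a + b) * a.factorial * b.factorial : ℂ) else 0 := by
  refine chInt_eq_of_recursion (by norm_num)
    (fun a b c d => if a = d ∧ b = c then
      (2 * Real.pi * 2 ^ (a + b) * a.factorial * b.factorial : ℂ) else 0) ?_ ?_ ?_ a b c d
  · intro a c
    by_cases h : a = 0 ∧ c = 0
    · simp [h.1, h.2]; ring
    · have : ¬ (a = 0 ∧ 0 = c) := fun h' => h ⟨h'.1, h'.2.symm⟩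
      simp [h, this]
  · intro a b c d
    by_cases h : a = d ∧ b = c
    · obtain ⟨rfl, rfl⟩ := h
      simp; ring
    · have : ¬ (c = b ∧ d = a) := fun h' => h ⟨h'.2.symm, h'.1.symm⟩
      simp [h, this]
  · intro a b c d
    rcases a with _ | a
    · simp
    · by_cases h : a = d ∧ b = c
      · obtain ⟨rfl, rfl⟩ := h
        simp [Nat.factorial_succ]; ring
      · simp [h]

theorem chInt_one (a b c d : ℕ) :
    chInt 1 a b c d
      = if a + c = b + d then (Real.pi * (-1) ^ (a + d) * (b + d).factorial : ℂ) else 0 := by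
  refine chInt_eq_of_recursion one_pos
    (fun a b c d => if a + c = b + d then
      (Real.pi * (-1) ^ (a + d) * (b + d).factorial : ℂ) else 0) ?_ ?_ ?_ a b c d
  · intro a c
    by_cases h : a = 0 ∧ c = 0
    · simp [h.1, h.2]
    · have : ¬ (a + c = 0 + 0) := by lia
      simp only [h, this, if_false]
  · intro a b c d
    by_cases h : a + c = b + d
    · have h' : c + a = d + b := by lia
      simp only [h, h', if_true, add_comm d b]
      -- The exponents have the same parity, their sum being `2 (b + d)`.
      have : ((-1 : ℂ)) ^ (a + d) = (-1) ^ (c + b) := by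
        have e : (-1 : ℂ) ^ (a + d) * (-1) ^ (c + b) = 1 := by
          rw [← pow_add, Even.neg_one_pow]
          exact ⟨b + d, by lia⟩
        rcases neg_one_pow_eq_or ℂ (a + d) with h1 | h1 <;>
          rcases neg_one_pow_eq_or ℂ (c + b) with h2 | h2 <;> rw [h1, h2] at e ⊢ <;> norm_num at e
      rw [this]
    · have h' : ¬ (c + a = d + b) := by lia
      simp only [h, h', if_false]
  · intro a b c d
    have e1 : (a : ℂ) * (if a - 1 + c = b + d then
        (Real.pi * (-1) ^ (a - 1 + d) * (b + d).factorial : ℂ) else 0)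
        = if a + c = b + (d + 1) then
          (a * (Real.pi * (-1) ^ (a + d + 1) * (b + d).factorial) : ℂ) else 0 := by
      rcases a with _ | a
      · simp
      · by_cases h : a + c = b + d
        · have h' : a + 1 + c = b + (d + 1) := by lia
          simp only [Nat.add_sub_cancel, h, h', if_true]; ring
        · have h' : ¬ (a + 1 + c = b + (d + 1)) := by lia
          simp only [Nat.add_sub_cancel, h, h', if_false, mul_zero]
    have e2 : (c : ℂ) * (if a + (c - 1) = b + d then
        (Real.pi * (-1) ^ (a + d) * (b + d).factorial : ℂ) else 0)
        = if a + c = b + (d + 1) then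
          (c * (Real.pi * (-1) ^ (a + d) * (b + d).factorial) : ℂ) else 0 := by
      rcases c with _ | c
      · simp
      · by_cases h : a + c = b + d
        · have h' : a + (c + 1) = b + (d + 1) := by lia
          simp only [Nat.add_sub_cancel, h, h', if_true]
        · have h' : ¬ (a + (c + 1) = b + (d + 1)) := by lia
          simp only [Nat.add_sub_cancel, h, h', if_false, mul_zero]
    rw [e1, mul_assoc (1 - 2 * ((1 : ℝ) : ℂ)), e2]
    by_cases h : a + c = b + (d + 1)
    · simp only [h, if_true]
      have h'' : (a : ℂ) + c = b + d + 1 := by exact_mod_cast h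
      rw [show b + (d + 1) = (b + d) + 1 by ring, Nat.factorial_succ]
      push_cast
      linear_combination (-Real.pi * (-1) ^ (a + d) * (b + d).factorial * (-1)) * h''
    · simp [h]

end GaussianIntegrals

/-! ### Special Hermite functions of one variable as eigenfunctions -/

section OneVariable

/-- The unnormalized special Hermite functions on `ℂ`. -/
def hermFun (a b : ℕ) (z : ℂ) : ℂ := chPoly a b z * (Real.exp (-(1 / 4 * ‖z‖ ^ 2)) : ℂ)

theorem mul_hermFun (a b : ℕ) (z : ℂ) :
    z * hermFun a b z = hermFun a (b + 1) z + 2 * a * hermFun (a - 1) b z := by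
  unfold hermFun
  linear_combination (Real.exp (-(1 / 4 * ‖z‖ ^ 2)) : ℂ) * mul_chPoly a b z

theorem conj_mul_hermFun (a b : ℕ) (z : ℂ) :
    conj z * hermFun a b z = hermFun (a + 1) b z + 2 * b * hermFun a (b - 1) z := by
  unfold hermFun
  linear_combination (Real.exp (-(1 / 4 * ‖z‖ ^ 2)) : ℂ) * conj_mul_chPoly a b z

/-- The derivative `∂/∂z` of `hermFun a b`. -/
def hermD (a b : ℕ) (z : ℂ) : ℂ := 1 / 2 * b * hermFun a (b - 1) z + (-1 / 4) * hermFun (a + 1) b z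

/-- The derivative `∂/∂ conj z` of `hermFun a b`. -/
def hermDbar (a b : ℕ) (z : ℂ) : ℂ :=
  1 / 2 * a * hermFun (a - 1) b z + (-1 / 4) * hermFun a (b + 1) z

/-- The Gaussian contributes `-z̄/4` or `-z/4`; the multiplication relations turn this into index
shifts and cancel half of the lowering term. -/
theorem hasFDerivAt_hermFun (a b : ℕ) (z : ℂ) :
    HasFDerivAt (hermFun a b) (wirt (hermD a b z) (hermDbar a b z)) z := by
  have h := hasFDerivAt_mul_wirt (hasFDerivAt_chPoly a b z) (hasFDerivAt_gauss_wirt (1 / 4) z)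
  refine h.congr_fderiv (congrArg₂ wirt ?_ ?_)
  · unfold hermD hermFun
    push_cast
    linear_combination (-1 / 4 * Complex.exp (-(1 / 4 * (‖z‖ : ℂ) ^ 2))) * conj_mul_chPoly a b z
  · unfold hermDbar hermFun
    push_cast
    linear_combination (-1 / 4 * Complex.exp (-(1 / 4 * (‖z‖ : ℂ) ^ 2))) * mul_chPoly a b z

theorem hasFDerivAt_hermD (a b : ℕ) (z : ℂ) :
    HasFDerivAt (hermD a b)
      (wirt (1 / 2 * b * hermD a (b - 1) z + (-1 / 4) * hermD (a + 1) b z)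
        (1 / 2 * b * hermDbar a (b - 1) z + (-1 / 4) * hermDbar (a + 1) b z)) z :=
  hasFDerivAt_add_wirt (hasFDerivAt_const_mul_wirt _ (hasFDerivAt_hermFun a (b - 1) z))
    (hasFDerivAt_const_mul_wirt _ (hasFDerivAt_hermFun (a + 1) b z))

theorem hasFDerivAt_hermDbar (a b : ℕ) (z : ℂ) :
    HasFDerivAt (hermDbar a b)
      (wirt (1 / 2 * a * hermD (a - 1) b z + (-1 / 4) * hermD a (b + 1) z)
        (1 / 2 * a * hermDbar (a - 1) b z + (-1 / 4) * hermDbar a (b + 1) z)) z :=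
  hasFDerivAt_add_wirt (hasFDerivAt_const_mul_wirt _ (hasFDerivAt_hermFun (a - 1) b z))
    (hasFDerivAt_const_mul_wirt _ (hasFDerivAt_hermFun a (b + 1) z))

/-- The derivative of a function on `ℂ` in the direction `v`. -/
def dirD (v : ℂ) (f : ℂ → ℂ) (z : ℂ) : ℂ := fderiv ℝ f z v

theorem dirD_hermFun (v : ℂ) (a b : ℕ) :
    dirD v (hermFun a b) = fun z => v * hermD a b z + conj v * hermDbar a b z := by
  funext z
  rw [dirD, (hasFDerivAt_hermFun a b z).fderiv, wirt_apply]; ring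

theorem hasFDerivAt_dirD_hermFun (v : ℂ) (a b : ℕ) (z : ℂ) :
    HasFDerivAt (dirD v (hermFun a b))
      (wirt (v * (1 / 2 * b * hermD a (b - 1) z + (-1 / 4) * hermD (a + 1) b z)
          + conj v * (1 / 2 * a * hermD (a - 1) b z + (-1 / 4) * hermD a (b + 1) z))
        (v * (1 / 2 * b * hermDbar a (b - 1) z + (-1 / 4) * hermDbar (a + 1) b z)
          + conj v * (1 / 2 * a * hermDbar (a - 1) b z + (-1 / 4) * hermDbar a (b + 1) z))) z := by
  rw [dirD_hermFun]
  exact hasFDerivAt_add_wirt (hasFDerivAt_const_mul_wirt v (hasFDerivAt_hermD a b z))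
    (hasFDerivAt_const_mul_wirt (conj v) (hasFDerivAt_hermDbar a b z))

/-- The special Hermite functions of one variable are eigenfunctions of the twisted Laplacian
of `ℂ`. -/
theorem twistedLaplacian_one_hermFun (a b : ℕ) (z : ℂ) :
    -(dirD 1 (dirD 1 (hermFun a b)) z + dirD Complex.I (dirD Complex.I (hermFun a b)) z)
      + 1 / 4 * ((‖z‖ ^ 2 : ℝ) : ℂ) * hermFun a b z
      - Complex.I * ((z.re : ℂ) * dirD Complex.I (hermFun a b) z
        - (z.im : ℂ) * dirD 1 (hermFun a b) z) = (2 * b + 1) * hermFun a b z := by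
  have e : ∀ v, dirD v (dirD v (hermFun a b)) z = fderiv ℝ (dirD v (hermFun a b)) z v := fun _ => rfl
  have hz : ((‖z‖ ^ 2 : ℝ) : ℂ) = z * conj z := by rw [Complex.mul_conj']; push_cast; rfl
  have hre : (z.re : ℂ) = (z + conj z) / 2 := by rw [Complex.re_eq_add_conj]
  have him : (z.im : ℂ) = -Complex.I * (z - conj z) / 2 := by
    rw [Complex.im_eq_sub_conj]
    field_simp
    linear_combination (z - conj z) * Complex.I_mul_I
  rw [e, e, (hasFDerivAt_dirD_hermFun _ a b z).fderiv, (hasFDerivAt_dirD_hermFun _ a b z).fderiv,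
    dirD_hermFun, dirD_hermFun, hz, hre, him]
  simp only [wirt_apply, map_one, Complex.conj_I]
  -- Here `Δ = 4 ∂²/∂z∂z̄` and `-i (x ∂_y - y ∂_x) = z ∂/∂z - z̄ ∂/∂z̄`. Each term is reduced to the
  -- indices `(a-1, b-1)`, `(a, b)`, `(a+1, b+1)`; the outer ones cancel and `(a, b)` receives `(a +
  -- b + 1) + (b - a) = 2b + 1`. The factors `a` and `b` absorb the truncated subtraction.
  have A1 : (a : ℂ) * hermFun (a - 1 + 1) b z = a * hermFun a b z := by rcases a with _ | a <;> simp
  have B1 : (b : ℂ) * hermFun a (b - 1 + 1) z = b * hermFun a b z := by rcases b with _ | b <;> simp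
  have m0 := mul_hermFun a (b - 1) z
  have m1 := mul_hermFun (a + 1) b z
  have m2 := conj_mul_hermFun (a - 1) b z
  have m3 := conj_mul_hermFun a (b + 1) z
  have m4 := conj_mul_hermFun a b z
  have hI := Complex.I_mul_I
  -- second derivatives
  have pq : 1 / 2 * (b : ℂ) * hermDbar a (b - 1) z + (-1 / 4) * hermDbar (a + 1) b z
      = 1 / 4 * (a * b * hermFun (a - 1) (b - 1) z) - (a + b + 1) / 8 * hermFun a b z
        + 1 / 16 * hermFun (a + 1) (b + 1) z := by
    unfold hermDbar
    simp only [Nat.add_sub_cancel]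
    push_cast
    linear_combination (-1 / 8) * B1
  have qp : 1 / 2 * (a : ℂ) * hermD (a - 1) b z + (-1 / 4) * hermD a (b + 1) z
      = 1 / 4 * (a * b * hermFun (a - 1) (b - 1) z) - (a + b + 1) / 8 * hermFun a b z
        + 1 / 16 * hermFun (a + 1) (b + 1) z := by
    unfold hermD
    simp only [Nat.add_sub_cancel]
    push_cast
    linear_combination (-1 / 8) * A1
  have zp : z * hermD a b z = (b - a - 1) / 2 * hermFun a b z
      + a * b * hermFun (a - 1) (b - 1) z - 1 / 4 * hermFun (a + 1) (b + 1) z := by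
    unfold hermD
    simp only [Nat.add_sub_cancel] at m1
    push_cast at m1
    linear_combination (1 / 2 * (b : ℂ)) * m0 + (-1 / 4) * m1 + 1 / 2 * B1
  have zq : conj z * hermDbar a b z = (a - b - 1) / 2 * hermFun a b z
      + a * b * hermFun (a - 1) (b - 1) z - 1 / 4 * hermFun (a + 1) (b + 1) z := by
    unfold hermDbar
    simp only [Nat.add_sub_cancel] at m3
    push_cast at m3
    linear_combination (1 / 2 * (a : ℂ)) * m2 + (-1 / 4) * m3 + 1 / 2 * A1
  have zz : z * conj z * hermFun a b z = hermFun (a + 1) (b + 1) z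
      + 2 * (a + b + 1) * hermFun a b z + 4 * (a * b * hermFun (a - 1) (b - 1) z) := by
    simp only [Nat.add_sub_cancel] at m1
    push_cast at m1
    linear_combination z * m4 + m1 + (2 * (b : ℂ)) * m0 + 2 * B1
  generalize 1 / 2 * (b : ℂ) * hermDbar a (b - 1) z + (-1 / 4) * hermDbar (a + 1) b z = fpq at *
  generalize 1 / 2 * (a : ℂ) * hermD (a - 1) b z + (-1 / 4) * hermD a (b + 1) z = fqp at *
  generalize 1 / 2 * (b : ℂ) * hermD a (b - 1) z + (-1 / 4) * hermD (a + 1) b z = fpp at *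
  generalize 1 / 2 * (a : ℂ) * hermDbar (a - 1) b z + (-1 / 4) * hermDbar a (b + 1) z = fqq at *
  linear_combination (-2) * pq + (-2) * qp + 1 / 4 * zz + zp - zq
    + (-(fpp + fqq) + (fpq + fqp) - (z * hermD a b z - conj z * hermDbar a b z)) * hI

end OneVariable

/-! ### Products in several variables -/

section SeveralVariables

variable {n : ℕ}

/-- The result is again a product of one-variable functions, written with `Function.update`, so that
the formula can be iterated for second derivatives. -/
theorem fderiv_prod_apply_single {f : Fin n → ℂ → ℂ} (hf : ∀ i, Differentiable ℝ (f i))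
    (j : Fin n) (v : ℂ) (z : Fin n → ℂ) :
    fderiv ℝ (fun z : Fin n → ℂ => ∏ i, f i (z i)) z (Pi.single j v)
      = ∏ i, Function.update f j (dirD v (f j)) i (z i) := by
  have h : ∀ i ∈ Finset.univ, HasFDerivAt (fun z : Fin n → ℂ => f i (z i))
      ((fderiv ℝ (f i) (z i)).comp (ContinuousLinearMap.proj i)) z := fun i _ =>
    HasFDerivAt.comp z (hf i (z i)).hasFDerivAt
      (ContinuousLinearMap.proj (R := ℝ) (φ := fun _ : Fin n => ℂ) i).hasFDerivAt
  rw [show fderiv ℝ (fun z : Fin n → ℂ => ∏ i, f i (z i)) z = _ from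
      (HasFDerivAt.finsetProd h).fderiv, sum_apply,
    Finset.sum_eq_single j]
  · rw [← Finset.mul_prod_erase _ _ (Finset.mem_univ j)]
    simp only [smul_apply, ContinuousLinearMap.comp_apply,
      ContinuousLinearMap.proj_apply, Pi.single_eq_same, smul_eq_mul, Function.update_self, dirD]
    rw [mul_comm]
    congr 1
    refine Finset.prod_congr rfl fun i hi => ?_
    rw [Function.update_of_ne (Finset.ne_of_mem_erase hi)]
  · intro i _ hij
    simp [Pi.single_eq_of_ne hij]
  · simp

theorem differentiable_update {f : Fin n → ℂ → ℂ} (hf : ∀ i, Differentiable ℝ (f i)) (j : Fin n)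
    {g : ℂ → ℂ} (hg : Differentiable ℝ g) (i : Fin n) :
    Differentiable ℝ (Function.update f j g i) := by
  by_cases h : i = j
  · subst h; rwa [Function.update_self]
  · rw [Function.update_of_ne h]; exact hf i

/-- The unnormalized special Hermite functions on `ℂⁿ`. -/
def hermProd (α β : Fin n → ℕ) (z : Fin n → ℂ) : ℂ := ∏ i, hermFun (α i) (β i) (z i)

theorem differentiable_hermFun (a b : ℕ) : Differentiable ℝ (hermFun a b) := fun z =>
  (hasFDerivAt_hermFun a b z).differentiableAt

/-- The operator is a sum of one-variable twisted Laplacians, whose eigenvalues `2 β j + 1` add up.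
-/
theorem twistedLaplacian_hermProd (α β : Fin n → ℕ) (z : Fin n → ℂ) :
    twistedLaplacian (hermProd α β) z = (2 * (∑ j, β j : ℕ) + n) * hermProd α β z := by
  set f : Fin n → ℂ → ℂ := fun i => hermFun (α i) (β i) with hf
  have hfd : ∀ i, Differentiable ℝ (f i) := fun i => differentiable_hermFun _ _
  have hdd : ∀ v i, Differentiable ℝ (dirD v (f i)) := fun v i z =>
    (hasFDerivAt_dirD_hermFun v (α i) (β i) z).differentiableAt
  have d1 : ∀ j v, (fun z => fderiv ℝ (hermProd α β) z (Pi.single j v))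
      = fun z => ∏ i, Function.update f j (dirD v (f j)) i (z i) := fun j v =>
    funext fun z => fderiv_prod_apply_single hfd j v z
  have d2 : ∀ j v z, fderiv ℝ (fun z => fderiv ℝ (hermProd α β) z (Pi.single j v)) z (Pi.single j v)
      = ∏ i, Function.update f j (dirD v (dirD v (f j))) i (z i) := fun j v z => by
    rw [d1, fderiv_prod_apply_single (differentiable_update hfd j (hdd v j))]
    simp only [Function.update_self, Function.update_idem]
  have split : ∀ j (g : ℂ → ℂ), ∏ i, Function.update f j g i (z i)
      = g (z j) * ∏ i ∈ Finset.univ.erase j, f i (z i) := fun j g => by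
    rw [← Finset.mul_prod_erase _ _ (Finset.mem_univ j), Function.update_self]
    congr 1
    refine Finset.prod_congr rfl fun i hi => ?_
    rw [Function.update_of_ne (Finset.ne_of_mem_erase hi)]
  have split0 : ∀ j, hermProd α β z = f j (z j) * ∏ i ∈ Finset.univ.erase j, f i (z i) := fun j =>
    (Finset.mul_prod_erase _ _ (Finset.mem_univ j)).symm
  have d1' : ∀ j v, fderiv ℝ (hermProd α β) z (Pi.single j v)
      = dirD v (f j) (z j) * ∏ i ∈ Finset.univ.erase j, f i (z i) := fun j v => by
    rw [← split]; exact congrFun (d1 j v) z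
  have key : twistedLaplacian (hermProd α β) z = ∑ j, (2 * (β j : ℂ) + 1) * hermProd α β z := by
    unfold twistedLaplacian partialX partialY
    rw [← Finset.sum_neg_distrib, Complex.ofReal_sum, Finset.mul_sum, Finset.sum_mul,
      Finset.mul_sum, ← Finset.sum_add_distrib, ← Finset.sum_sub_distrib]
    refine Finset.sum_congr rfl fun j _ => ?_
    rw [d2, d2, d1', d1', split, split, split0 j]
    have := twistedLaplacian_one_hermFun (α j) (β j) (z j)
    simp only [hf]
    linear_combination (∏ i ∈ Finset.univ.erase j, hermFun (α i) (β i) (z i)) * this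
  rw [key, ← Finset.sum_mul, Finset.sum_add_distrib, ← Finset.mul_sum]
  push_cast
  simp

/-- The norm of `Fin n → ℂ` is the sup norm, whereas the Gaussians involve the Euclidean one; this
comparison gives the domination required by `expNeg`. -/
theorem norm_sq_le_sum (z : Fin n → ℂ) : ‖z‖ ^ 2 ≤ ∑ j, ‖z j‖ ^ 2 := by
  have h0 : 0 ≤ ∑ j, ‖z j‖ ^ 2 := Finset.sum_nonneg fun _ _ => by positivity
  rw [← Real.le_sqrt (norm_nonneg _) h0, pi_norm_le_iff_of_nonneg (Real.sqrt_nonneg _)]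
  intro i
  rw [Real.le_sqrt (norm_nonneg _) h0]
  exact Finset.single_le_sum (f := fun j => ‖z j‖ ^ 2) (fun _ _ => by positivity) (Finset.mem_univ i)

theorem hasTemperateGrowth_coord (j : Fin n) :
    Function.HasTemperateGrowth (fun z : Fin n → ℂ => z j) :=
  (ContinuousLinearMap.proj (R := ℝ) (φ := fun _ : Fin n => ℂ) j).hasTemperateGrowth

theorem hasTemperateGrowth_sum_norm_sq (c : ℝ) :
    Function.HasTemperateGrowth (fun z : Fin n → ℂ => c * ∑ j, ‖z j‖ ^ 2) :=
  (Function.HasTemperateGrowth.const c).mul (Function.HasTemperateGrowth.sum fun j _ =>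
    (Function.hasTemperateGrowth_norm_sq ℂ).comp (hasTemperateGrowth_coord j))

/-- The Gaussian `exp(-c|z|²)` on `ℂⁿ` as a Schwartz function. -/
def gaussN (n : ℕ) (c : ℝ) (hc : 0 < c) : 𝓢(Fin n → ℂ, ℂ) :=
  expNeg (fun z : Fin n → ℂ => c * ∑ j, ‖z j‖ ^ 2) (hasTemperateGrowth_sum_norm_sq c) hc
    fun z => by gcongr; exact norm_sq_le_sum z

theorem gaussN_apply (c : ℝ) (hc : 0 < c) (z : Fin n → ℂ) :
    gaussN n c hc z = (Real.exp (-(c * ∑ j, ‖z j‖ ^ 2)) : ℂ) := rfl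

theorem hasTemperateGrowth_finsetProd {ι E : Type*} [NormedAddCommGroup E] [NormedSpace ℝ E]
    (s : Finset ι) {f : ι → E → ℂ} (hf : ∀ i, (f i).HasTemperateGrowth) :
    Function.HasTemperateGrowth (fun x => ∏ i ∈ s, f i x) := by
  classical
  induction s using Finset.induction_on with
  | empty => exact Function.HasTemperateGrowth.const (1 : ℂ)
  | insert i s hi ih =>
    simp only [Finset.prod_insert hi]
    exact (hf i).mul ih

/-- The special Hermite functions as Schwartz functions. -/
def hermS (α β : Fin n → ℕ) : 𝓢(Fin n → ℂ, ℂ) :=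
  SchwartzMap.smulLeftCLM ℂ (fun z : Fin n → ℂ => ∏ i, chPoly (α i) (β i) (z i))
    (gaussN n (1 / 4) (by norm_num))

theorem hermS_coe (α β : Fin n → ℕ) : ⇑(hermS α β) = hermProd α β := by
  funext z
  have hP : Function.HasTemperateGrowth (fun z : Fin n → ℂ => ∏ i, chPoly (α i) (β i) (z i)) :=
    hasTemperateGrowth_finsetProd _ fun i =>
      (hasTemperateGrowth_chPoly (α i) (β i)).comp (hasTemperateGrowth_coord i)
  rw [hermS, SchwartzMap.smulLeftCLM_apply_apply hP, gaussN_apply, smul_eq_mul, hermProd]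
  unfold hermFun
  rw [Finset.prod_mul_distrib, ← Complex.ofReal_prod, ← Real.exp_sum, Finset.sum_neg_distrib,
    Finset.mul_sum]

end SeveralVariables

/-! ### Formal self-adjointness of the twisted Laplacian -/

section FormalAdjoint

variable {n : ℕ}

/-- The inclusion of the Schwartz functions in `L²(ℂⁿ)`. -/
def toL2 : 𝓢(Fin n → ℂ, ℂ) →L[ℂ] L2 n := SchwartzMap.toLpCLM ℂ ℂ 2 volume

theorem coeFn_toL2 (φ : 𝓢(Fin n → ℂ, ℂ)) : (toL2 φ : (Fin n → ℂ) → ℂ) =ᵐ[volume] φ :=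
  φ.coeFn_toLp 2 volume

/-- `S` is a formal adjoint of `T` on Schwartz functions. -/
def FormalAdjoint (T S : 𝓢(Fin n → ℂ, ℂ) →L[ℂ] 𝓢(Fin n → ℂ, ℂ)) : Prop :=
  ∀ φ ψ, ⟪toL2 (T φ), toL2 ψ⟫_ℂ = ⟪toL2 φ, toL2 (S ψ)⟫_ℂ

variable {T S T' S' : 𝓢(Fin n → ℂ, ℂ) →L[ℂ] 𝓢(Fin n → ℂ, ℂ)}

theorem inner_toLp (φ ψ : 𝓢(Fin n → ℂ, ℂ)) :
    ⟪toL2 φ, toL2 ψ⟫_ℂ = ∫ z, conj (φ z) * ψ z := by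
  rw [L2.inner_def]
  refine integral_congr_ae ?_
  filter_upwards [coeFn_toL2 φ, coeFn_toL2 ψ] with z h1 h2
  rw [h1, h2, RCLike.inner_apply']

theorem FormalAdjoint.add (h : FormalAdjoint T S) (h' : FormalAdjoint T' S') :
    FormalAdjoint (T + T') (S + S') := fun φ ψ => by
  simp only [add_apply, map_add, inner_add_left, inner_add_right, h φ ψ, h' φ ψ]

theorem FormalAdjoint.smul (c : ℂ) (h : FormalAdjoint T S) :
    FormalAdjoint (c • T) (conj c • S) := fun φ ψ => by
  simp only [smul_apply, map_smul, inner_smul_left, inner_smul_right, h φ ψ]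

theorem FormalAdjoint.comp (h : FormalAdjoint T S) (h' : FormalAdjoint T' S') :
    FormalAdjoint (T.comp T') (S'.comp S) := fun φ ψ => by
  rw [ContinuousLinearMap.comp_apply, ContinuousLinearMap.comp_apply, h, h']

theorem FormalAdjoint.sum {ι : Type*} (s : Finset ι)
    {T S : ι → 𝓢(Fin n → ℂ, ℂ) →L[ℂ] 𝓢(Fin n → ℂ, ℂ)} (h : ∀ i, FormalAdjoint (T i) (S i)) :
    FormalAdjoint (∑ i ∈ s, T i) (∑ i ∈ s, S i) := by
  classical
  induction s using Finset.induction_on with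
  | empty => intro φ ψ; simp
  | insert i s hi ih =>
    rw [Finset.sum_insert hi, Finset.sum_insert hi]
    exact (h i).add ih

open LineDeriv in
/-- The directional derivative on Schwartz functions. -/
def lineD (v : Fin n → ℂ) : 𝓢(Fin n → ℂ, ℂ) →L[ℂ] 𝓢(Fin n → ℂ, ℂ) :=
  lineDerivOpCLM ℂ 𝓢(Fin n → ℂ, ℂ) v

theorem lineD_apply (v : Fin n → ℂ) (φ : 𝓢(Fin n → ℂ, ℂ)) (z : Fin n → ℂ) :
    lineD v φ z = fderiv ℝ φ z v := rfl

theorem formalAdjoint_lineD (v : Fin n → ℂ) : FormalAdjoint (lineD v) (-lineD v) := fun φ ψ => by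
  have h := SchwartzMap.integral_bilinear_lineDerivOp_right_eq_neg_left (μ := volume) φ ψ
    ((ContinuousLinearMap.mul ℝ ℂ).comp (Complex.conjCLE : ℂ →L[ℝ] ℂ)) v
  have e : (-lineD v) ψ = (-1 : ℂ) • lineD v ψ := by simp
  rw [e, map_smul, inner_smul_right, inner_toLp, inner_toLp]
  change ∫ z, conj (φ z) * lineD v ψ z = -∫ z, conj (lineD v φ z) * ψ z at h
  rw [h]
  simp

/-- Multiplication by a real temperate function. -/
def mulReal (h : (Fin n → ℂ) → ℝ) : 𝓢(Fin n → ℂ, ℂ) →L[ℂ] 𝓢(Fin n → ℂ, ℂ) :=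
  SchwartzMap.smulLeftCLM ℂ fun z => (h z : ℂ)

theorem mulReal_apply {h : (Fin n → ℂ) → ℝ} (hh : h.HasTemperateGrowth) (φ : 𝓢(Fin n → ℂ, ℂ))
    (z : Fin n → ℂ) : mulReal h φ z = h z * φ z := by
  have : Function.HasTemperateGrowth fun z => (h z : ℂ) :=
    Complex.ofRealCLM.hasTemperateGrowth.comp hh
  rw [mulReal, SchwartzMap.smulLeftCLM_apply_apply this, smul_eq_mul]

theorem formalAdjoint_mulReal {h : (Fin n → ℂ) → ℝ} (hh : h.HasTemperateGrowth) :
    FormalAdjoint (mulReal h) (mulReal h) := fun φ ψ => by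
  rw [inner_toLp, inner_toLp]
  congr 1
  funext z
  rw [mulReal_apply hh, mulReal_apply hh, map_mul, Complex.conj_ofReal]
  ring

/-- Applied to `x_j` with `∂/∂y_j` and to `y_j` with `∂/∂x_j`, so that the rotation term needs no
reordering when adjoints are taken. -/
theorem lineD_mulReal_comm (L : (Fin n → ℂ) →L[ℝ] ℝ) {v : Fin n → ℂ} (hv : L v = 0) :
    (lineD v).comp (mulReal L) = (mulReal L).comp (lineD v) := by
  ext φ z
  have hL : (⇑L).HasTemperateGrowth := L.hasTemperateGrowth
  simp only [ContinuousLinearMap.comp_apply, lineD_apply]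
  rw [mulReal_apply hL, lineD_apply]
  have e : ⇑(mulReal L φ) = fun z => (L z : ℂ) * φ z := funext fun z => mulReal_apply hL φ z
  rw [e]
  have h1 : HasFDerivAt (fun z => (L z : ℂ)) (Complex.ofRealCLM.comp L) z :=
    (Complex.ofRealCLM.comp L).hasFDerivAt
  rw [(h1.fun_mul φ.differentiableAt.hasFDerivAt).fderiv]
  simp [hv]

/-- The twisted Laplacian as an operator on Schwartz functions. -/
def twistedLaplacianS (n : ℕ) : 𝓢(Fin n → ℂ, ℂ) →L[ℂ] 𝓢(Fin n → ℂ, ℂ) :=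
  (-1 : ℂ) • (∑ j, ((lineD (Pi.single j 1)).comp (lineD (Pi.single j 1))
      + (lineD (Pi.single j Complex.I)).comp (lineD (Pi.single j Complex.I))))
    + mulReal (fun z => 1 / 4 * ∑ j, ‖z j‖ ^ 2)
    + (-Complex.I) • ∑ j, ((mulReal (Complex.reCLM.comp (ContinuousLinearMap.proj j))).comp
        (lineD (Pi.single j Complex.I))
      + (-1 : ℂ) • (mulReal (Complex.imCLM.comp (ContinuousLinearMap.proj j))).comp
        (lineD (Pi.single j 1)))

theorem twistedLaplacianS_apply (φ : 𝓢(Fin n → ℂ, ℂ)) (z : Fin n → ℂ) :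
    twistedLaplacianS n φ z = twistedLaplacian φ z := by
  have e : ∀ v, ⇑(lineD v φ) = fun z => fderiv ℝ φ z v := fun v => rfl
  simp only [twistedLaplacianS, twistedLaplacian, partialX, partialY, add_apply,
    smul_apply, sum_apply, ContinuousLinearMap.comp_apply, smul_eq_mul]
  rw [mulReal_apply (hasTemperateGrowth_sum_norm_sq _)]
  simp only [mulReal_apply (ContinuousLinearMap.hasTemperateGrowth _), lineD_apply]
  have e1 : ∀ j, partialX j φ = fun z => fderiv ℝ φ z (Pi.single j 1) := fun j => rfl
  have e2 : ∀ j, partialY j φ = fun z => fderiv ℝ φ z (Pi.single j Complex.I) := fun j => rfl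
  simp [e, e1, e2]
  simp only [← sub_eq_add_neg, Finset.sum_sub_distrib]

/-- Second derivatives pick up two signs; the rotation field is formally skew, which the factor `-i`
turns into symmetric. -/
theorem formalAdjoint_twistedLaplacianS : FormalAdjoint (twistedLaplacianS n) (twistedLaplacianS n) := by
  unfold twistedLaplacianS
  refine FormalAdjoint.add (FormalAdjoint.add ?_ (formalAdjoint_mulReal
    (hasTemperateGrowth_sum_norm_sq _))) ?_
  · have := FormalAdjoint.smul (-1) (FormalAdjoint.sum Finset.univ fun j : Fin n =>
      ((formalAdjoint_lineD (Pi.single j 1)).comp (formalAdjoint_lineD (Pi.single j 1))).add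
      ((formalAdjoint_lineD (Pi.single j Complex.I)).comp
        (formalAdjoint_lineD (Pi.single j Complex.I))))
    simpa using this
  · have h1 : ∀ j : Fin n, FormalAdjoint
        ((mulReal (Complex.reCLM.comp (ContinuousLinearMap.proj j))).comp
          (lineD (Pi.single j Complex.I)))
        ((-1 : ℂ) • (mulReal (Complex.reCLM.comp (ContinuousLinearMap.proj j))).comp
          (lineD (Pi.single j Complex.I))) := fun j => by
      have := (formalAdjoint_mulReal (ContinuousLinearMap.hasTemperateGrowth
        (Complex.reCLM.comp (ContinuousLinearMap.proj (R := ℝ) (φ := fun _ : Fin n => ℂ) j)))).comp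
        (formalAdjoint_lineD (Pi.single j Complex.I))
      rw [ContinuousLinearMap.neg_comp, lineD_mulReal_comm _ (by simp)] at this
      simpa using this
    have h2 : ∀ j : Fin n, FormalAdjoint
        ((mulReal (Complex.imCLM.comp (ContinuousLinearMap.proj j))).comp
          (lineD (Pi.single j 1)))
        ((-1 : ℂ) • (mulReal (Complex.imCLM.comp (ContinuousLinearMap.proj j))).comp
          (lineD (Pi.single j 1))) := fun j => by
      have := (formalAdjoint_mulReal (ContinuousLinearMap.hasTemperateGrowth
        (Complex.imCLM.comp (ContinuousLinearMap.proj (R := ℝ) (φ := fun _ : Fin n => ℂ) j)))).comp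
        (formalAdjoint_lineD (Pi.single j 1))
      rw [ContinuousLinearMap.neg_comp, lineD_mulReal_comm _ (by simp)] at this
      simpa using this
    have := FormalAdjoint.smul (-Complex.I) (FormalAdjoint.sum Finset.univ fun j : Fin n =>
      (h1 j).add ((h2 j).smul (-1)))
    convert this using 1
    simp only [map_neg, Complex.conj_I, map_one, neg_neg, ← Finset.smul_sum, smul_add, smul_smul,
      Finset.sum_add_distrib]
    simp

end FormalAdjoint

/-! ### Classical eigenfunctions against the distributional eigenspaces -/

section Eigenspaces

variable {n : ℕ}

theorem toLp_mem_eigenspace {φ : 𝓢(Fin n → ℂ, ℂ)} {lam : ℝ}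
    (h : ∀ z, twistedLaplacian φ z = lam * φ z) : toL2 φ ∈ eigenspace n lam := by
  rw [eigenspace, Submodule.mem_orthogonal]
  intro u hu
  induction hu using Submodule.span_induction with
  | zero => simp
  | add x y _ _ hx hy => rw [inner_add_left, hx, hy, add_zero]
  | smul c x _ hx => rw [inner_smul_left, hx, mul_zero]
  | mem x hx =>
    obtain ⟨ψ, hψ⟩ := hx
    have e : x = toL2 (twistedLaplacianS n ψ - (lam : ℂ) • ψ) := by
      apply Lp.ext
      filter_upwards [hψ, coeFn_toL2 (twistedLaplacianS n ψ - (lam : ℂ) • ψ)] with z h1 h2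
      rw [h1, h2, sub_apply, smul_apply, twistedLaplacianS_apply, smul_eq_mul]
    have hφ : twistedLaplacianS n φ = (lam : ℂ) • φ := by
      ext z
      rw [twistedLaplacianS_apply, h, smul_apply, smul_eq_mul]
    rw [e, map_sub, map_smul, inner_sub_left, inner_smul_left, formalAdjoint_twistedLaplacianS,
      hφ, map_smul, inner_smul_right, Complex.conj_ofReal, sub_self]

/-- The vector `𝓛φ - lam φ = (mu - lam) φ` is one of those to which the eigenspace is orthogonal by
definition. -/
theorem inner_eq_zero_of_mem_eigenspace {φ : 𝓢(Fin n → ℂ, ℂ)} {lam mu : ℝ} (hne : mu ≠ lam)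
    (h : ∀ z, twistedLaplacian φ z = mu * φ z) {f : L2 n} (hf : f ∈ eigenspace n lam) :
    ⟪toL2 φ, f⟫_ℂ = 0 := by
  rw [eigenspace, Submodule.mem_orthogonal] at hf
  have hmem : (((mu : ℂ) - lam) • toL2 φ : L2 n) ∈ {g : L2 n | ∃ φ : 𝓢(Fin n → ℂ, ℂ),
      (g : (Fin n → ℂ) → ℂ) =ᵐ[volume] fun z => twistedLaplacian φ z - (lam : ℂ) * φ z} := by
    refine ⟨φ, ?_⟩
    rw [← map_smul]
    filter_upwards [coeFn_toL2 (((mu : ℂ) - lam) • φ)] with z hz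
    rw [hz, smul_apply, h, smul_eq_mul]; ring
  have := hf _ (Submodule.subset_span hmem)
  rw [inner_smul_left, mul_eq_zero] at this
  refine this.resolve_left ?_
  rw [map_sub, Complex.conj_ofReal, Complex.conj_ofReal, sub_eq_zero]
  exact_mod_cast hne

end Eigenspaces

/-! ### Uniqueness for the Fourier transform -/

section FourierUniqueness

variable {E : Type*} [NormedAddCommGroup E] [NormedSpace ℝ E] [MeasurableSpace E]
  [BorelSpace E] {μ : Measure E}

theorem integrable_mul_exp_dual {h : E → ℂ} (hh : Integrable h μ) (L : StrongDual ℝ E) :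
    Integrable (fun x => h x * Complex.exp (L x * Complex.I)) μ := by
  refine hh.mul_bdd (c := 1) (by fun_prop) (Filter.Eventually.of_forall fun x => ?_)
  rw [Complex.norm_exp_ofReal_mul_I]

/-- A real integrable function with vanishing Fourier transform vanishes almost everywhere. -/
theorem ae_eq_zero_of_fourier_eq_zero_real [CompleteSpace E] [SecondCountableTopology E]
    [SigmaFinite μ] {r : E → ℝ} (hr : Integrable r μ)
    (h : ∀ L : StrongDual ℝ E, ∫ x, (r x : ℂ) * Complex.exp (L x * Complex.I) ∂μ = 0) :
    r =ᵐ[μ] 0 := by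
  have hp : AEMeasurable (fun x => ENNReal.ofReal (r x)) μ := hr.1.aemeasurable.ennreal_ofReal
  have hm : AEMeasurable (fun x => ENNReal.ofReal (-r x)) μ := hr.neg.1.aemeasurable.ennreal_ofReal
  have f1 : IsFiniteMeasure (μ.withDensity fun x => ENNReal.ofReal (r x)) :=
    isFiniteMeasure_withDensity_ofReal hr.2
  have f2 : IsFiniteMeasure (μ.withDensity fun x => ENNReal.ofReal (-r x)) :=
    isFiniteMeasure_withDensity_ofReal hr.neg.2
  -- The positive and negative parts of `r` are densities of finite measures with equal
  -- characteristic functions, so these measures coincide.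
  have heq : (μ.withDensity fun x => ENNReal.ofReal (r x))
      = μ.withDensity fun x => ENNReal.ofReal (-r x) := by
    apply Measure.ext_of_charFunDual
    funext L
    rw [charFunDual_apply, charFunDual_apply,
      integral_withDensity_eq_integral_toReal_smul₀ hp (by simp),
      integral_withDensity_eq_integral_toReal_smul₀ hm (by simp), ← sub_eq_zero, ← integral_sub]
    · rw [← h L]
      refine integral_congr_ae (Filter.Eventually.of_forall fun x => ?_)
      simp only [ENNReal.toReal_ofReal', Complex.real_smul]
      rw [← sub_mul]
      congr 1
      norm_cast
      rcases le_total (r x) 0 with h0 | h0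
      · rw [max_eq_right h0, max_eq_left (by linarith)]; ring
      · rw [max_eq_left h0, max_eq_right (by linarith)]; ring
    · have := integrable_mul_exp_dual (hr.pos_part.ofReal (𝕜 := ℂ)) L
      simp only [ENNReal.toReal_ofReal', Complex.real_smul]
      exact this
    · have := integrable_mul_exp_dual (hr.neg.pos_part.ofReal (𝕜 := ℂ)) L
      simp only [ENNReal.toReal_ofReal', Complex.real_smul]
      exact this
  rw [withDensity_eq_iff_of_sigmaFinite hp hm] at heq
  filter_upwards [heq] with x hx
  rcases lt_trichotomy (r x) 0 with h0 | h0 | h0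
  · rw [ENNReal.ofReal_of_nonpos h0.le, eq_comm, ENNReal.ofReal_eq_zero] at hx; linarith
  · exact h0
  · rw [ENNReal.ofReal_of_nonpos (show -r x ≤ 0 by linarith), ENNReal.ofReal_eq_zero] at hx; linarith

/-- An integrable function with vanishing Fourier transform vanishes almost everywhere. -/
theorem ae_eq_zero_of_fourier_eq_zero [CompleteSpace E] [SecondCountableTopology E]
    [SigmaFinite μ] {f : E → ℂ} (hf : Integrable f μ)
    (h : ∀ L : StrongDual ℝ E, ∫ x, f x * Complex.exp (L x * Complex.I) ∂μ = 0) :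
    f =ᵐ[μ] 0 := by
  -- Conjugation replaces `L` by `-L`; hence the real and imaginary parts of `f` also have vanishing
  -- transforms.
  have hc : ∀ L : StrongDual ℝ E, ∫ x, conj (f x) * Complex.exp (L x * Complex.I) ∂μ = 0 := fun L => by
    have := congrArg conj (h (-L))
    rw [← integral_conj, map_zero] at this
    rw [← this]
    congr 1; funext x
    rw [map_mul, ← Complex.exp_conj]
    simp
  have hfc : Integrable (fun x => conj (f x)) μ :=
    (Complex.conjCLE : ℂ →L[ℝ] ℂ).integrable_comp hf
  have hre := ae_eq_zero_of_fourier_eq_zero_real (r := fun x => (f x).re) hf.re fun L => by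
    have e : ∀ x, ((f x).re : ℂ) * Complex.exp (L x * Complex.I) = 1 / 2 *
        (f x * Complex.exp (L x * Complex.I) + conj (f x) * Complex.exp (L x * Complex.I)) := fun x => by
      rw [Complex.re_eq_add_conj]; ring
    simp_rw [e]
    rw [integral_const_mul, integral_add (integrable_mul_exp_dual hf L)
      (integrable_mul_exp_dual hfc L), h, hc]
    simp
  have him := ae_eq_zero_of_fourier_eq_zero_real (r := fun x => (f x).im) hf.im fun L => by
    have e : ∀ x, ((f x).im : ℂ) * Complex.exp (L x * Complex.I) = 1 / (2 * Complex.I) *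
        (f x * Complex.exp (L x * Complex.I) - conj (f x) * Complex.exp (L x * Complex.I)) := fun x => by
      rw [Complex.im_eq_sub_conj]; ring
    simp_rw [e]
    rw [integral_const_mul, integral_sub (integrable_mul_exp_dual hf L)
      (integrable_mul_exp_dual hfc L), h, hc]
    simp
  filter_upwards [hre, him] with x h1 h2
  exact Complex.ext h1 h2

end FourierUniqueness

/-! ### Completeness of the special Hermite functions -/

section Completeness

variable {n : ℕ}

theorem hermProd_eq_mul_erase (j : Fin n) (α β : Fin n → ℕ) (z : Fin n → ℂ) :
    hermProd α β z = hermFun (α j) (β j) (z j)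
      * ∏ i ∈ Finset.univ.erase j, hermFun (α i) (β i) (z i) :=
  (Finset.mul_prod_erase _ _ (Finset.mem_univ j)).symm

theorem hermProd_update_left (j : Fin n) (a : ℕ) (α β : Fin n → ℕ) (z : Fin n → ℂ) :
    hermProd (Function.update α j a) β z = hermFun a (β j) (z j)
      * ∏ i ∈ Finset.univ.erase j, hermFun (α i) (β i) (z i) := by
  rw [hermProd_eq_mul_erase j, Function.update_self]
  congr 1
  refine Finset.prod_congr rfl fun i hi => ?_
  rw [Function.update_of_ne (Finset.ne_of_mem_erase hi)]

theorem hermProd_update_right (j : Fin n) (b : ℕ) (α β : Fin n → ℕ) (z : Fin n → ℂ) :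
    hermProd α (Function.update β j b) z = hermFun (α j) b (z j)
      * ∏ i ∈ Finset.univ.erase j, hermFun (α i) (β i) (z i) := by
  rw [hermProd_eq_mul_erase j, Function.update_self]
  congr 1
  refine Finset.prod_congr rfl fun i hi => ?_
  rw [Function.update_of_ne (Finset.ne_of_mem_erase hi)]

theorem coord_mul_hermProd (j : Fin n) (α β : Fin n → ℕ) (z : Fin n → ℂ) :
    z j * hermProd α β z = hermProd α (Function.update β j (β j + 1)) z
      + 2 * α j * hermProd (Function.update α j (α j - 1)) β z := by
  rw [hermProd_eq_mul_erase j α β, hermProd_update_left, hermProd_update_right]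
  linear_combination (∏ i ∈ Finset.univ.erase j, hermFun (α i) (β i) (z i)) *
    mul_hermFun (α j) (β j) (z j)

theorem conj_coord_mul_hermProd (j : Fin n) (α β : Fin n → ℕ) (z : Fin n → ℂ) :
    conj (z j) * hermProd α β z = hermProd (Function.update α j (α j + 1)) β z
      + 2 * β j * hermProd α (Function.update β j (β j - 1)) z := by
  rw [hermProd_eq_mul_erase j α β, hermProd_update_left, hermProd_update_right]
  linear_combination (∏ i ∈ Finset.univ.erase j, hermFun (α i) (β i) (z i)) *
    conj_mul_hermFun (α j) (β j) (z j)

/-- The span of the special Hermite functions. -/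
def hermSpan (n : ℕ) : Submodule ℂ ((Fin n → ℂ) → ℂ) :=
  Submodule.span ℂ (Set.range fun p : (Fin n → ℕ) × (Fin n → ℕ) => hermProd p.1 p.2)

theorem hermProd_mem (α β : Fin n → ℕ) : hermProd α β ∈ hermSpan n :=
  Submodule.subset_span ⟨(α, β), rfl⟩

theorem mul_mem_hermSpan {m : (Fin n → ℂ) → ℂ} (hm : ∀ α β, m * hermProd α β ∈ hermSpan n)
    {f : (Fin n → ℂ) → ℂ} (hf : f ∈ hermSpan n) : m * f ∈ hermSpan n := by
  induction hf using Submodule.span_induction with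
  | zero => rw [mul_zero]; exact zero_mem _
  | add x y _ _ hx hy => rw [mul_add]; exact add_mem hx hy
  | smul c x _ hx => rw [mul_smul_comm]; exact Submodule.smul_mem _ _ hx
  | mem x hx => obtain ⟨p, rfl⟩ := hx; exact hm _ _

theorem coord_mul_mem (j : Fin n) {f : (Fin n → ℂ) → ℂ} (hf : f ∈ hermSpan n) :
    (fun z => z j) * f ∈ hermSpan n := by
  refine mul_mem_hermSpan (fun α β => ?_) hf
  have : (fun z : Fin n → ℂ => z j) * hermProd α β = hermProd α (Function.update β j (β j + 1))
      + (2 * α j : ℂ) • hermProd (Function.update α j (α j - 1)) β :=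
    funext fun z => coord_mul_hermProd j α β z
  rw [this]
  exact add_mem (hermProd_mem _ _) (Submodule.smul_mem _ _ (hermProd_mem _ _))

theorem conj_coord_mul_mem (j : Fin n) {f : (Fin n → ℂ) → ℂ} (hf : f ∈ hermSpan n) :
    (fun z => conj (z j)) * f ∈ hermSpan n := by
  refine mul_mem_hermSpan (fun α β => ?_) hf
  have : (fun z : Fin n → ℂ => conj (z j)) * hermProd α β
      = hermProd (Function.update α j (α j + 1)) β
      + (2 * β j : ℂ) • hermProd α (Function.update β j (β j - 1)) :=
    funext fun z => conj_coord_mul_hermProd j α β z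
  rw [this]
  exact add_mem (hermProd_mem _ _) (Submodule.smul_mem _ _ (hermProd_mem _ _))

/-- A real functional is a combination of the `z_j` and `z̄_j` with coefficients `(L e_j ∓ i L (i
e_j)) / 2`. Iteration puts every power of `L` times the Gaussian in the span. -/
theorem dual_mul_mem (L : StrongDual ℝ (Fin n → ℂ)) {f : (Fin n → ℂ) → ℂ} (hf : f ∈ hermSpan n) :
    (fun z => (L z : ℂ)) * f ∈ hermSpan n := by
  have e : (fun z => (L z : ℂ)) * f = ∑ j, ((((L (Pi.single j 1) : ℝ) : ℂ)
        - Complex.I * ((L (Pi.single j Complex.I) : ℝ) : ℂ)) / 2) • ((fun z => z j) * f)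
      + ∑ j, ((((L (Pi.single j 1) : ℝ) : ℂ)
        + Complex.I * ((L (Pi.single j Complex.I) : ℝ) : ℂ)) / 2) • ((fun z => conj (z j)) * f) := by
    funext z
    have hz : L z = ∑ j, ((z j).re * L (Pi.single j 1) + (z j).im * L (Pi.single j Complex.I)) := by
      conv_lhs => rw [← Finset.univ_sum_single z]
      rw [map_sum]
      refine Finset.sum_congr rfl fun j _ => ?_
      rw [← smul_eq_mul, ← smul_eq_mul, ← map_smul, ← map_smul, ← map_add]
      congr 1
      rw [← Pi.single_smul, ← Pi.single_smul, ← Pi.single_add]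
      congr 1
      rw [Complex.real_smul, Complex.real_smul, mul_one, Complex.re_add_im]
    simp only [Pi.mul_apply, Pi.add_apply, Finset.sum_apply, Pi.smul_apply, smul_eq_mul]
    rw [hz, ← Finset.sum_add_distrib, Complex.ofReal_sum, Finset.sum_mul]
    refine Finset.sum_congr rfl fun j _ => ?_
    push_cast
    rw [Complex.re_eq_add_conj, Complex.im_eq_sub_conj]
    field_simp
    linear_combination (f z * (z j - conj (z j)) * ((L (Pi.single j Complex.I) : ℝ) : ℂ)) *
      Complex.I_mul_I
  rw [e]
  exact add_mem (sum_mem fun j _ => Submodule.smul_mem _ _ (coord_mul_mem j hf))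
    (sum_mem fun j _ => Submodule.smul_mem _ _ (conj_coord_mul_mem j hf))

theorem hermProd_zero (z : Fin n → ℂ) : hermProd 0 0 z = gaussN n (1 / 4) (by norm_num) z := by
  rw [← hermS_coe, hermS, SchwartzMap.smulLeftCLM_apply_apply]
  · simp [chPoly_zero_right]
  · exact hasTemperateGrowth_finsetProd _ fun i =>
      (hasTemperateGrowth_chPoly _ _).comp (hasTemperateGrowth_coord i)

/-- The special Hermite functions span a dense subspace of `L²(ℂⁿ)`. -/
theorem eq_zero_of_inner_hermS_eq_zero {f : L2 n}
    (h : ∀ α β, ⟪toL2 (hermS α β), f⟫_ℂ = 0) : f = 0 := by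
  set g := gaussN n (1 / 4) (by norm_num) with hg
  have hspan : ∀ P ∈ hermSpan n, ∃ φ : 𝓢(Fin n → ℂ, ℂ), ⇑φ = P ∧ ⟪toL2 φ, f⟫_ℂ = 0 := by
    intro P hP
    induction hP using Submodule.span_induction with
    | zero => exact ⟨0, rfl, by simp⟩
    | add x y _ _ hx hy =>
      obtain ⟨φ, hφ, hφ'⟩ := hx
      obtain ⟨ψ, hψ, hψ'⟩ := hy
      exact ⟨φ + ψ, by rw [← hφ, ← hψ]; rfl, by rw [map_add, inner_add_left, hφ', hψ', add_zero]⟩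
    | smul c x _ hx =>
      obtain ⟨φ, hφ, hφ'⟩ := hx
      exact ⟨c • φ, by rw [← hφ]; rfl, by rw [map_smul, inner_smul_left, hφ', mul_zero]⟩
    | mem x hx =>
      obtain ⟨p, rfl⟩ := hx
      exact ⟨hermS p.1 p.2, hermS_coe _ _, h _ _⟩
  -- Orthogonality to the span says that all moments of `g f` along `L` vanish.
  have hmom : ∀ (L : StrongDual ℝ (Fin n → ℂ)) (m : ℕ), ∫ z, (L z : ℂ) ^ m * (g z * f z) = 0 := by
    intro L m
    have hmem : (fun z => (L z : ℂ)) ^ m * hermProd 0 0 ∈ hermSpan n := by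
      induction m with
      | zero => rw [pow_zero, one_mul]; exact hermProd_mem _ _
      | succ m ih => rw [pow_succ', mul_assoc]; exact dual_mul_mem L ih
    obtain ⟨φ, hφ, hφ'⟩ := hspan _ hmem
    rw [L2.inner_def] at hφ'
    rw [← hφ']
    refine integral_congr_ae ?_
    filter_upwards [coeFn_toL2 φ] with z hz
    rw [hz, RCLike.inner_apply', hφ]
    simp only [Pi.mul_apply, Pi.pow_apply, hermProd_zero, map_mul, map_pow, Complex.conj_ofReal,
      gaussN_apply, hg]
    ring
  have hfm : MemLp (f : (Fin n → ℂ) → ℂ) 2 volume := Lp.memLp f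
  have hgf : Integrable (fun z => g z * f z) := (g.memLp 2).integrable_mul hfm
  have hL : ∀ L : StrongDual ℝ (Fin n → ℂ), ∫ z, (g z * f z) * Complex.exp (L z * Complex.I) = 0 := by
    intro L
    -- From `(4‖L‖ - ‖z‖)² ≥ 0` one gets `‖L‖‖z‖ ≤ 2‖L‖² + ‖z‖²/8`: half of the Gaussian exponent
    -- absorbs `exp |L z|`. This is the majorant for integrating the exponential series term by
    -- term.
    have hbound : Integrable (fun z => Real.exp |L z| * ‖g z * f z‖) := by
      have h8 : Integrable (fun z => gaussN n (1 / 8) (by norm_num) z * f z) :=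
        ((gaussN n (1 / 8) (by norm_num)).memLp 2).integrable_mul hfm
      refine (h8.norm.const_mul (Real.exp (2 * ‖L‖ ^ 2))).mono' ?_ (Filter.Eventually.of_forall ?_)
      · have c1 : Continuous fun z => Real.exp |L z| := by fun_prop
        exact c1.aestronglyMeasurable.mul hgf.1.norm
      · intro z
        rw [norm_mul, norm_norm, norm_mul, norm_mul, gaussN_apply, gaussN_apply,
          Complex.norm_real, Complex.norm_real, Real.norm_of_nonneg (Real.exp_pos _).le,
          Real.norm_of_nonneg (Real.exp_pos _).le, Real.norm_of_nonneg (Real.exp_pos _).le,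
          ← mul_assoc, ← mul_assoc, ← Real.exp_add, ← Real.exp_add]
        refine mul_le_mul_of_nonneg_right (Real.exp_le_exp.mpr ?_) (norm_nonneg _)
        have h1 : |L z| ≤ ‖L‖ * ‖z‖ := L.le_opNorm z
        have h2 := norm_sq_le_sum z
        nlinarith [sq_nonneg (4 * ‖L‖ - ‖z‖)]
    have hs := hasSum_integral_of_dominated_convergence (μ := volume)
      (F := fun (m : ℕ) z => ((L z : ℂ) * Complex.I) ^ m / (m.factorial : ℂ) * (g z * f z))
      (f := fun z => (g z * f z) * Complex.exp (L z * Complex.I))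
      (fun m z => |L z| ^ m / m.factorial * ‖g z * f z‖) ?_ ?_ ?_ ?_ ?_
    · have e0 : ∀ m : ℕ, ∫ z, ((L z : ℂ) * Complex.I) ^ m / (m.factorial : ℂ) * (g z * f z) = 0 := by
        intro m
        have : ∀ z, ((L z : ℂ) * Complex.I) ^ m / (m.factorial : ℂ) * (g z * f z)
            = (Complex.I ^ m / (m.factorial : ℂ)) * ((L z : ℂ) ^ m * (g z * f z)) := fun z => by ring
        simp_rw [this]
        rw [integral_const_mul, hmom, mul_zero]
      simp_rw [e0] at hs
      exact hs.unique hasSum_zero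
    · intro m
      have c1 : Continuous fun z => ((L z : ℂ) * Complex.I) ^ m / (m.factorial : ℂ) := by fun_prop
      exact c1.aestronglyMeasurable.mul hgf.1
    · intro m
      refine Filter.Eventually.of_forall fun z => ?_
      simp
    · refine Filter.Eventually.of_forall fun z => ?_
      exact (Real.summable_pow_div_factorial |L z|).mul_right _
    · refine hbound.congr (Filter.Eventually.of_forall fun z => ?_)
      simp only
      rw [tsum_mul_right, Real.exp_eq_exp_ℝ, NormedSpace.exp_eq_tsum_div]
    · refine Filter.Eventually.of_forall fun z => ?_
      have := (NormedSpace.expSeries_div_hasSum_exp ((L z : ℂ) * Complex.I)).mul_right (g z * f z)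
      rw [← Complex.exp_eq_exp_ℂ, mul_comm (Complex.exp _)] at this
      exact this
  have := ae_eq_zero_of_fourier_eq_zero hgf hL
  rw [Lp.eq_zero_iff_ae_eq_zero]
  filter_upwards [this] with z hz
  have : g z ≠ 0 := by
    rw [hg, gaussN_apply]
    exact_mod_cast (Real.exp_pos _).ne'
  simpa [this] using hz

end Completeness

/-! ### The Hilbert basis and orthogonality of eigenspaces -/

section HermiteBasis

variable {n : ℕ}

/-- The norm of the special Hermite function `hermProd α β`. -/
def hermNorm (α β : Fin n → ℕ) : ℝ :=
  ∏ j, √(2 * Real.pi * 2 ^ (α j + β j) * (α j).factorial * (β j).factorial)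

theorem hermNorm_pos (α β : Fin n → ℕ) : 0 < hermNorm α β :=
  Finset.prod_pos fun _ _ => Real.sqrt_pos.mpr (by have := Real.pi_pos; positivity)

/-- Fubini factorizes the integral; the two factors `exp(-|z|²/4)` raise `c` by `1/2`, and
conjugation exchanges `α` and `β`. The case `c = 0` gives inner products, `c = 1/2` the matrix
elements of the potential. -/
theorem integral_conj_hermProd_mul (c : ℝ) (α β α' β' : Fin n → ℕ) :
    ∫ z, conj (hermProd α β z) * (Real.exp (-(c * ∑ j, ‖z j‖ ^ 2)) : ℂ) * hermProd α' β' z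
      = ∏ j, chInt (c + 1 / 2) (β j) (α j) (α' j) (β' j) := by
  unfold chInt
  rw [← integral_fintype_prod_volume_eq_prod (𝕜 := ℂ) (E := fun _ : Fin n => ℂ) fun j z =>
    chPoly (β j) (α j) z * chPoly (α' j) (β' j) z * (Real.exp (-((c + 1 / 2) * ‖z‖ ^ 2)) : ℂ)]
  congr 1
  funext z
  unfold hermProd hermFun
  rw [map_prod, Finset.mul_sum, ← Finset.sum_neg_distrib, Real.exp_sum, Complex.ofReal_prod,
    ← Finset.prod_mul_distrib, ← Finset.prod_mul_distrib]
  refine Finset.prod_congr rfl fun j _ => ?_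
  rw [map_mul, conj_chPoly, Complex.conj_ofReal]
  have : Real.exp (-((c + 1 / 2) * ‖z j‖ ^ 2)) = Real.exp (-(1 / 4 * ‖z j‖ ^ 2))
      * Real.exp (-(c * ‖z j‖ ^ 2)) * Real.exp (-(1 / 4 * ‖z j‖ ^ 2)) := by
    rw [← Real.exp_add, ← Real.exp_add]; ring_nf
  rw [this]
  push_cast
  ring

/-- The normalized special Hermite functions as elements of `L²(ℂⁿ)`. -/
def hermL2 (p : (Fin n → ℕ) × (Fin n → ℕ)) : L2 n :=
  ((hermNorm p.1 p.2 : ℂ)⁻¹) • toL2 (hermS p.1 p.2)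

theorem inner_toL2_hermS (α β α' β' : Fin n → ℕ) :
    ⟪toL2 (hermS α β), toL2 (hermS α' β')⟫_ℂ
      = if (α, β) = (α', β') then ((hermNorm α β : ℂ) ^ 2) else 0 := by
  have h := integral_conj_hermProd_mul 0 α β α' β'
  simp only [zero_mul, neg_zero, Real.exp_zero, Complex.ofReal_one, mul_one, zero_add] at h
  rw [inner_toLp, hermS_coe, hermS_coe, h]
  simp_rw [chInt_half]
  split_ifs with hp
  · obtain ⟨rfl, rfl⟩ := Prod.mk.inj hp
    rw [hermNorm, Complex.ofReal_prod, ← Finset.prod_pow]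
    refine Finset.prod_congr rfl fun j _ => ?_
    rw [if_pos ⟨rfl, rfl⟩, ← Complex.ofReal_pow,
      Real.sq_sqrt (by have := Real.pi_pos; positivity)]
    push_cast
    rw [add_comm (β j)]
    ring
  · have : ∃ j, ¬ (β j = β' j ∧ α j = α' j) := by
      by_contra hc
      push Not at hc
      exact hp (Prod.ext (funext fun j => (hc j).2) (funext fun j => (hc j).1))
    obtain ⟨j, hj⟩ := this
    exact Finset.prod_eq_zero (Finset.mem_univ j) (if_neg hj)

theorem orthonormal_hermL2 : Orthonormal ℂ (hermL2 (n := n)) := by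
  classical
  rw [orthonormal_iff_ite]
  intro p p'
  rw [hermL2, hermL2, inner_smul_left, inner_smul_right, inner_toL2_hermS]
  have h := (hermNorm_pos p.1 p.2).ne'
  by_cases hp : p = p'
  · subst hp
    have h' : (hermNorm p.1 p.2 : ℂ) ≠ 0 := by exact_mod_cast h
    simp only [if_true, map_inv₀, Complex.conj_ofReal]
    field_simp
  · rw [if_neg hp, if_neg (by simpa using hp)]
    simp

/-- The special Hermite functions form a Hilbert basis of `L²(ℂⁿ)`. -/
def hermBasis (n : ℕ) : HilbertBasis ((Fin n → ℕ) × (Fin n → ℕ)) ℂ (L2 n) :=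
  HilbertBasis.mkOfOrthogonalEqBot orthonormal_hermL2 (by
    rw [Submodule.eq_bot_iff]
    intro f hf
    apply eq_zero_of_inner_hermS_eq_zero
    intro α β
    have h := (Submodule.mem_orthogonal _ _).1 hf _ (Submodule.subset_span ⟨(α, β), rfl⟩)
    rw [hermL2, inner_smul_left, mul_eq_zero] at h
    refine h.resolve_left ?_
    simpa using (hermNorm_pos α β).ne')

theorem hermBasis_apply (p : (Fin n → ℕ) × (Fin n → ℕ)) : hermBasis n p = hermL2 p := by
  simp [hermBasis]

theorem twistedLaplacian_hermS (α β : Fin n → ℕ) (z : Fin n → ℂ) :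
    twistedLaplacian (hermS α β) z = ((2 * (∑ j, β j : ℕ) + n : ℝ) : ℂ) * hermS α β z := by
  rw [hermS_coe, twistedLaplacian_hermProd]
  push_cast
  ring

theorem hermL2_mem_eigenspace (p : (Fin n → ℕ) × (Fin n → ℕ)) {k : ℕ} (hk : ∑ j, p.2 j = k) :
    hermL2 p ∈ eigenspace n (2 * k + n) := by
  subst hk
  exact Submodule.smul_mem _ _ (toLp_mem_eigenspace (twistedLaplacian_hermS p.1 p.2))

theorem inner_hermL2_eq_zero {p : (Fin n → ℕ) × (Fin n → ℕ)} {k : ℕ} (hk : ∑ j, p.2 j ≠ k)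
    {f : L2 n} (hf : f ∈ eigenspace n (2 * k + n)) : ⟪hermL2 p, f⟫_ℂ = 0 := by
  rw [hermL2, inner_smul_left,
    inner_eq_zero_of_mem_eigenspace ?_ (twistedLaplacian_hermS p.1 p.2) hf, mul_zero]
  intro h
  apply hk
  have : ((∑ j, p.2 j : ℕ) : ℝ) = k := by linarith
  exact_mod_cast this

/-- Eigenspaces of the twisted Laplacian for different eigenvalues are orthogonal. -/
theorem inner_eq_zero_of_ne {k l : ℕ} (hkl : k ≠ l) {f g : L2 n}
    (hf : f ∈ eigenspace n (2 * k + n)) (hg : g ∈ eigenspace n (2 * l + n)) : ⟪f, g⟫_ℂ = 0 := by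
  -- Completeness enters here, because the eigenspaces are only defined weakly: a basis vector with
  -- `|β| ≠ k` is orthogonal to `f`, and one with `|β| = k ≠ l` is orthogonal to `g`.
  rw [← (hermBasis n).tsum_inner_mul_inner f g]
  convert tsum_zero with p
  rw [hermBasis_apply]
  by_cases h : ∑ j, p.2 j = k
  · rw [inner_hermL2_eq_zero (by rw [h]; exact hkl) hg, mul_zero]
  · rw [← inner_conj_symm, inner_hermL2_eq_zero h hf, map_zero, zero_mul]

end HermiteBasis

/-! ### The Schrödinger propagator -/

section Propagator

variable {n : ℕ}

theorem orthogonalFamily_eigenspace (n : ℕ) :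
    OrthogonalFamily ℂ (fun k : ℕ => eigenspace n (2 * k + n))
      (fun k : ℕ => (eigenspace n (2 * k + n)).subtypeₗᵢ) :=
  fun _ _ hkl f g => inner_eq_zero_of_ne hkl f.2 g.2

theorem spectralProj_mem (k : ℕ) (f : L2 n) : spectralProj n k f ∈ eigenspace n (2 * k + n) :=
  Submodule.starProjection_apply_mem _ _

theorem norm_phase (t : ℝ) (k n : ℕ) : ‖Complex.exp (-Complex.I * t * (2 * k + n))‖ = 1 := by
  have : -Complex.I * t * (2 * k + n) = ((-(t * (2 * k + n)) : ℝ) : ℂ) * Complex.I := by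
    push_cast; ring
  rw [this, Complex.norm_exp_ofReal_mul_I]

theorem norm_sq_sum_phase (t : ℝ) (f : L2 n) (s : Finset ℕ) :
    ‖∑ k ∈ s, Complex.exp (-Complex.I * t * (2 * k + n)) • spectralProj n k f‖ ^ 2
      = ∑ k ∈ s, ‖spectralProj n k f‖ ^ 2 := by
  have h := (orthogonalFamily_eigenspace n).norm_sum (fun k =>
    Complex.exp (-Complex.I * t * (2 * k + n)) • (⟨spectralProj n k f, spectralProj_mem k f⟩ :
      eigenspace n (2 * k + n))) s
  simp only [norm_smul, norm_phase, one_mul] at h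
  exact h

/-- Bessel's inequality: the partial sum `P f` satisfies `⟨f, P f⟩ = ‖P f‖²`, and Cauchy–Schwarz
applies. -/
theorem sum_norm_sq_spectralProj_le (f : L2 n) (s : Finset ℕ) :
    ∑ k ∈ s, ‖spectralProj n k f‖ ^ 2 ≤ ‖f‖ ^ 2 := by
  have h1 := norm_sq_sum_phase 0 f s
  simp only [Complex.ofReal_zero, mul_zero, zero_mul, Complex.exp_zero, one_smul] at h1
  have h2 : RCLike.re ⟪f, ∑ k ∈ s, spectralProj n k f⟫_ℂ = ∑ k ∈ s, ‖spectralProj n k f‖ ^ 2 := by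
    rw [inner_sum, map_sum]
    refine Finset.sum_congr rfl fun k _ => ?_
    have e : spectralProj n k (spectralProj n k f) = spectralProj n k f :=
      Submodule.starProjection_eq_self_iff.2 (spectralProj_mem k f)
    have e2 : ⟪spectralProj n k f, spectralProj n k f⟫_ℂ = ⟪f, spectralProj n k (spectralProj n k f)⟫_ℂ :=
      Submodule.inner_starProjection_left_eq_right _ _ _
    rw [← inner_self_eq_norm_sq (𝕜 := ℂ), e2, e]
  have h3 := re_inner_le_norm (𝕜 := ℂ) f (∑ k ∈ s, spectralProj n k f)
  rw [h2, ← h1] at h3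
  rw [← h1]
  have h0 := norm_nonneg (∑ k ∈ s, spectralProj n k f)
  have h4 : ‖∑ k ∈ s, spectralProj n k f‖ ≤ ‖f‖ := by
    by_contra hc
    push Not at hc
    nlinarith [norm_nonneg f]
  gcongr

/-- Without summability the `tsum` defining the propagator would take the default value `0`. -/
theorem summable_propagator (t : ℝ) (f : L2 n) :
    Summable fun k : ℕ => Complex.exp (-Complex.I * t * (2 * k + n)) • spectralProj n k f := by
  refine ((orthogonalFamily_eigenspace n).summable_iff_norm_sq_summable fun k =>
    Complex.exp (-Complex.I * t * (2 * k + n)) • (⟨spectralProj n k f, spectralProj_mem k f⟩ :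
      eigenspace n (2 * k + n))).2 ?_
  simp only [norm_smul, norm_phase, one_mul]
  exact summable_of_sum_le (fun _ => by positivity) (sum_norm_sq_spectralProj_le f)

theorem norm_propagator_le (t : ℝ) (f : L2 n) : ‖propagator n t f‖ ≤ ‖f‖ := by
  refine le_of_tendsto (summable_propagator t f).hasSum.norm (Filter.Eventually.of_forall fun s => ?_)
  have := (norm_sq_sum_phase t f s).trans_le (sum_norm_sq_spectralProj_le f s)
  exact le_of_sq_le_sq this (norm_nonneg f)

/-- The propagator as a continuous linear map. -/
def propagatorL (n : ℕ) (t : ℝ) : L2 n →L[ℂ] L2 n :=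
  LinearMap.mkContinuous
    { toFun := propagator n t
      map_add' := fun f g => by
        unfold propagator
        rw [← (summable_propagator t f).tsum_add (summable_propagator t g)]
        simp only [map_add, smul_add]
      map_smul' := fun c f => by
        simp only [propagator, RingHom.id_apply]
        rw [← tsum_const_smul'' c]
        simp only [map_smul, smul_comm c] } 1 fun f => by
    rw [one_mul]; exact norm_propagator_le t f

theorem propagatorL_apply (t : ℝ) (f : L2 n) : propagatorL n t f = propagator n t f := rfl

theorem stronglyMeasurable_propagator (f : L2 n) :
    StronglyMeasurable fun t => propagator n t f := by
  refine stronglyMeasurable_of_tendsto Filter.atTop (f := fun N (t : ℝ) => ∑ k ∈ Finset.range N,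
    Complex.exp (-Complex.I * t * (2 * k + n)) • spectralProj n k f) (fun N => ?_)
    (tendsto_pi_nhds.2 fun t => (summable_propagator t f).hasSum.tendsto_sum_nat)
  exact Continuous.stronglyMeasurable (by fun_prop)

theorem propagator_of_mem {k : ℕ} {f : L2 n} (hf : f ∈ eigenspace n (2 * k + n)) (t : ℝ) :
    propagator n t f = Complex.exp (-Complex.I * t * (2 * k + n)) • f := by
  unfold propagator
  rw [tsum_eq_single k]
  · congr 1
    exact Submodule.starProjection_eq_self_iff.2 hf
  · intro l hl
    have : spectralProj n l f = 0 := by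
      unfold spectralProj
      rw [Submodule.starProjection_apply_eq_zero_iff, Submodule.mem_orthogonal]
      exact fun u hu => inner_eq_zero_of_ne hl hu hf
    rw [this, smul_zero]

end Propagator

/-! ### The Gaussian potential as a multiplication operator -/

section Potential

variable {n : ℕ}

/-- The Gaussian potential `exp(-|z|²/2)`. -/
def potential (n : ℕ) (z : Fin n → ℂ) : ℝ := Real.exp (-(1 / 2 * ∑ j, ‖z j‖ ^ 2))

theorem gaussN_half_apply (z : Fin n → ℂ) : gaussN n (1 / 2) one_half_pos z = (potential n z : ℂ) := rfl

theorem potential_pos (z : Fin n → ℂ) : 0 < potential n z := Real.exp_pos _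

theorem continuous_potential : Continuous (potential n) := by
  unfold potential; fun_prop

/-- Multiplication by the potential on `L²(ℂⁿ)`. -/
def potentialMul (n : ℕ) : L2 n →L[ℂ] L2 n :=
  (ContinuousLinearMap.mul ℂ ℂ).holderL volume ∞ 2 2 ((gaussN n (1 / 2) one_half_pos).toLp ∞ volume)

theorem coeFn_potentialMul (f : L2 n) :
    (potentialMul n f : (Fin n → ℂ) → ℂ) =ᵐ[volume] fun z => (potential n z : ℂ) * f z := by
  have h := (ContinuousLinearMap.mul ℂ ℂ).coeFn_holder (r := 2)
    ((gaussN n (1 / 2) one_half_pos).toLp ∞ volume) f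
  filter_upwards [h, (gaussN n (1 / 2) one_half_pos).coeFn_toLp ∞ volume] with z h1 h2
  refine Eq.trans h1 ?_
  rw [h2]
  rfl

theorem inner_potentialMul_congr (f g : L2 n) :
    (fun z => ⟪(f : (Fin n → ℂ) → ℂ) z, (potentialMul n g : (Fin n → ℂ) → ℂ) z⟫_ℂ) =ᵐ[volume]
      fun z => conj (f z) * (potential n z : ℂ) * g z := by
  filter_upwards [coeFn_potentialMul g] with z hz
  rw [hz, RCLike.inner_apply']; ring

theorem integrable_potential (f g : L2 n) :
    Integrable fun z => conj (f z) * (potential n z : ℂ) * g z :=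
  (L2.integrable_inner f (potentialMul n g)).congr (inner_potentialMul_congr f g)

theorem inner_potentialMul (f g : L2 n) :
    ⟪f, potentialMul n g⟫_ℂ = ∫ z, conj (f z) * (potential n z : ℂ) * g z := by
  rw [L2.inner_def]
  exact integral_congr_ae (inner_potentialMul_congr f g)

theorem inner_potentialMul_self (f : L2 n) :
    ⟪f, potentialMul n f⟫_ℂ = ((∫ z, potential n z * ‖f z‖ ^ 2 : ℝ) : ℂ) := by
  rw [inner_potentialMul, ← integral_complex_ofReal]
  congr 1
  funext z
  rw [mul_right_comm, Complex.conj_mul']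
  push_cast
  ring

end Potential

/-! ### The time average of the potential -/

section TimeAverage

variable {n : ℕ}

theorem norm_inner_propagator_le (f g : L2 n) (t : ℝ) :
    ‖⟪propagator n t f, potentialMul n (propagator n t g)⟫_ℂ‖ ≤ ‖potentialMul n‖ * ‖f‖ * ‖g‖ := by
  calc _ ≤ ‖propagator n t f‖ * ‖potentialMul n (propagator n t g)‖ := norm_inner_le_norm _ _
    _ ≤ ‖f‖ * (‖potentialMul n‖ * ‖g‖) := by
      gcongr
      · exact norm_propagator_le t f
      · exact (ContinuousLinearMap.le_opNorm _ _).trans (by gcongr; exact norm_propagator_le t g)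
    _ = _ := by ring

theorem integrableOn_inner_propagator (f g : L2 n) :
    IntegrableOn (fun t => ⟪propagator n t f, potentialMul n (propagator n t g)⟫_ℂ)
      (Ioo (-Real.pi) Real.pi) := by
  refine Integrable.of_bound ?_ (‖potentialMul n‖ * ‖f‖ * ‖g‖)
    (Filter.Eventually.of_forall (norm_inner_propagator_le f g))
  exact ((stronglyMeasurable_propagator f).inner
    ((potentialMul n).continuous.comp_stronglyMeasurable
      (stronglyMeasurable_propagator g))).aestronglyMeasurable

/-- The sesquilinear form of the time average. -/
def timeForm (n : ℕ) : L2 n →L⋆[ℂ] L2 n →L[ℂ] ℂ :=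
  LinearMap.mkContinuous₂ (LinearMap.mk₂'ₛₗ (starRingEnd ℂ) (RingHom.id ℂ)
    (fun f g : L2 n => ∫ t in Ioo (-Real.pi) Real.pi,
      ⟪propagator n t f, potentialMul n (propagator n t g)⟫_ℂ)
    (fun f f' g => by
      simp only [← propagatorL_apply, map_add, inner_add_left]
      exact integral_add (integrableOn_inner_propagator f g) (integrableOn_inner_propagator f' g))
    (fun c f g => by
      simp only [← propagatorL_apply, map_smul, inner_smul_left]
      exact integral_const_mul _ _)
    (fun f g g' => by
      simp only [← propagatorL_apply, map_add, inner_add_right]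
      exact integral_add (integrableOn_inner_propagator f g) (integrableOn_inner_propagator f g'))
    (fun c f g => by
      simp only [← propagatorL_apply, map_smul, inner_smul_right]
      exact integral_const_mul _ _))
    (‖potentialMul n‖ * (2 * Real.pi)) fun f g => by
      have h := norm_setIntegral_le_of_norm_le_const (μ := volume) (s := Ioo (-Real.pi) Real.pi)
        (f := fun t => ⟪propagator n t f, potentialMul n (propagator n t g)⟫_ℂ)
        (C := ‖potentialMul n‖ * ‖f‖ * ‖g‖) (by simp) fun t _ => norm_inner_propagator_le f g t
      refine h.trans (le_of_eq ?_)
      rw [Measure.real, Real.volume_Ioo, ENNReal.toReal_ofReal (by linarith [Real.pi_pos])]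
      ring

/-- The time average `∫ e^{it𝓛} v e^{-it𝓛} dt` of the Gaussian potential. -/
def timeAverage (n : ℕ) : L2 n →L[ℂ] L2 n :=
  ContinuousLinearMap.adjoint (InnerProductSpace.continuousLinearMapOfBilin (timeForm n))

/-- `continuousLinearMapOfBilin` places the operator in the left entry of the inner product; the
adjoint in `timeAverage` moves it to the right. -/
theorem inner_timeAverage (f g : L2 n) :
    ⟪f, timeAverage n g⟫_ℂ = ∫ t in Ioo (-Real.pi) Real.pi,
      ⟪propagator n t f, potentialMul n (propagator n t g)⟫_ℂ := by
  rw [timeAverage, ContinuousLinearMap.adjoint_inner_right,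
    InnerProductSpace.continuousLinearMapOfBilin_apply]
  rfl

theorem isTimeAverage_timeAverage : IsTimeAverage (fun _ => potential n) (timeAverage n) := by
  intro f g
  refine ⟨Filter.Eventually.of_forall fun t => integrable_potential _ _, ?_, ?_⟩
  · have := integrableOn_inner_propagator f g
    simpa only [inner_potentialMul] using this
  · rw [inner_timeAverage]
    simp only [inner_potentialMul]

theorem inner_timeAverage_self (f : L2 n) :
    ⟪f, timeAverage n f⟫_ℂ = ((∫ t in Ioo (-Real.pi) Real.pi,
      ∫ z, potential n z * ‖propagator n t f z‖ ^ 2 : ℝ) : ℂ) := by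
  rw [inner_timeAverage, ← integral_complex_ofReal]
  simp only [inner_potentialMul_self]

theorem isPositive_timeAverage : (timeAverage n).IsPositive := by
  rw [ContinuousLinearMap.isPositive_iff_complex]
  intro f
  have h : ⟪timeAverage n f, f⟫_ℂ = ((∫ t in Ioo (-Real.pi) Real.pi,
      ∫ z, potential n z * ‖propagator n t f z‖ ^ 2 : ℝ) : ℂ) := by
    rw [← inner_conj_symm, inner_timeAverage_self, Complex.conj_ofReal]
  rw [h]
  refine ⟨by simp, ?_⟩
  simp only [RCLike.re_to_complex, Complex.ofReal_re]
  exact integral_nonneg fun t => integral_nonneg fun z =>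
    mul_nonneg (potential_pos z).le (by positivity)

/-- The phases of the two propagators cancel, and `2π` is the length of the time interval. -/
theorem inner_timeAverage_of_mem {k : ℕ} {f : L2 n} (hf : f ∈ eigenspace n (2 * k + n)) :
    ⟪f, timeAverage n f⟫_ℂ = 2 * Real.pi * ⟪f, potentialMul n f⟫_ℂ := by
  rw [inner_timeAverage]
  have : ∀ t, ⟪propagator n t f, potentialMul n (propagator n t f)⟫_ℂ = ⟪f, potentialMul n f⟫_ℂ := by
    intro t
    rw [propagator_of_mem hf, map_smul, inner_smul_left, inner_smul_right, ← mul_assoc,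
      Complex.conj_mul', norm_phase]
    simp
  simp only [this, setIntegral_const]
  rw [Measure.real, Real.volume_Ioo, ENNReal.toReal_ofReal (by linarith [Real.pi_pos]),
    Complex.real_smul]
  push_cast
  ring

end TimeAverage

/-! ### Moments and traces of positive operators -/

section Trace

variable {H : Type*} [NormedAddCommGroup H] [InnerProductSpace ℂ H] [CompleteSpace H]

theorem exists_selfAdjoint_sqrt {T : H →L[ℂ] H} (hT : T.IsPositive) :
    ∃ R : H →L[ℂ] H, IsSelfAdjoint R ∧ R * R = T := by
  have h0 : 0 ≤ T := (ContinuousLinearMap.nonneg_iff_isPositive T).2 hT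
  exact ⟨CFC.sqrt T, (CFC.sqrt_nonneg T).isSelfAdjoint, CFC.sqrt_mul_sqrt_self T h0⟩

theorem inner_pow_two_mul {R : H →L[ℂ] H} (hR : IsSelfAdjoint R) (m : ℕ) (x y : H) :
    ⟪x, (R ^ (2 * m)) y⟫_ℂ = ⟪(R ^ m) x, (R ^ m) y⟫_ℂ := by
  have h : IsSelfAdjoint (R ^ m) := hR.pow m
  rw [two_mul, pow_add, mul_apply_eq_comp, ← ContinuousLinearMap.adjoint_inner_left,
    ← ContinuousLinearMap.star_eq_adjoint, h.star_eq]

/-- Jensen's inequality for the moments of a positive operator. -/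
theorem pow_inner_le_inner_pow {T : H →L[ℂ] H} (hT : T.IsPositive) {x : H} (hx : ‖x‖ = 1) (m : ℕ) :
    (RCLike.re ⟪x, T x⟫_ℂ) ^ m ≤ RCLike.re ⟪x, (T ^ m) x⟫_ℂ := by
  obtain ⟨R, hR, rfl⟩ := exists_selfAdjoint_sqrt hT
  rw [← pow_two, ← pow_mul, inner_pow_two_mul hR]
  have h1 : RCLike.re ⟪x, (R ^ 2) x⟫_ℂ = ‖(R ^ 1) x‖ ^ 2 := by
    have := inner_pow_two_mul hR 1 x x
    rw [mul_one] at this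
    rw [this, inner_self_eq_norm_sq]
  rw [h1, inner_self_eq_norm_sq, ← pow_mul, mul_comm, pow_mul]
  refine pow_le_pow_left₀ (by positivity) ?_ 2
  -- With `T = R²` the claim is `‖R x‖^m ≤ ‖R^m x‖`. Cauchy–Schwarz makes `i ↦ ‖R^i x‖` log-convex,
  -- so its successive ratios increase from `‖R x‖ / ‖x‖ = ‖R x‖`.
  have hconv : ∀ i, ‖(R ^ (i + 1)) x‖ ^ 2 ≤ ‖(R ^ i) x‖ * ‖(R ^ (i + 2)) x‖ := fun i => by
    have h2 := inner_pow_two_mul hR (i + 1) x x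
    have h3 : ⟪x, (R ^ (2 * (i + 1))) x⟫_ℂ = ⟪(R ^ i) x, (R ^ (i + 2)) x⟫_ℂ := by
      rw [show 2 * (i + 1) = i + (i + 2) by ring, pow_add, mul_apply_eq_comp,
        ← ContinuousLinearMap.adjoint_inner_left, ← ContinuousLinearMap.star_eq_adjoint,
        (hR.pow i).star_eq]
    rw [← inner_self_eq_norm_sq (𝕜 := ℂ), ← h2, h3]
    exact re_inner_le_norm _ _
  have hstep : ∀ i, ‖(R ^ 1) x‖ * ‖(R ^ i) x‖ ≤ ‖(R ^ (i + 1)) x‖ := by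
    intro i
    induction i with
    | zero => simp [hx]
    | succ i ih =>
      rcases (norm_nonneg ((R ^ i) x)).eq_or_lt with h0 | h0
      · have : (R ^ (i + 1)) x = 0 := by
          rw [pow_succ', mul_apply_eq_comp, norm_eq_zero.1 h0.symm, map_zero]
        rw [this, norm_zero, mul_zero]; positivity
      · have := hconv i
        have h5 := mul_le_mul_of_nonneg_left ih (norm_nonneg ((R ^ (i + 1)) x))
        refine le_of_mul_le_mul_left ?_ h0
        nlinarith
  induction m with
  | zero => simp [hx]
  | succ m ih =>
    rw [pow_succ']
    exact (mul_le_mul_of_nonneg_left ih (norm_nonneg _)).trans (hstep m)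

/-- The sum of the squares `‖S f_j‖²` over an orthonormal system is at most that over a Hilbert
basis. -/
theorem sum_norm_sq_le_tsum {ι κ : Type*} [Fintype κ] (b : HilbertBasis ι ℂ H) {f : κ → H}
    (hf : Orthonormal ℂ f) {S : H →L[ℂ] H} (hS : IsSelfAdjoint S) :
    ∑ j, ENNReal.ofReal (‖S (f j)‖ ^ 2) ≤ ∑' i, ENNReal.ofReal (‖S (b i)‖ ^ 2) := by
  have hparseval : ∀ x : H, ENNReal.ofReal (‖x‖ ^ 2) = ∑' i, ENNReal.ofReal (‖⟪b i, x⟫_ℂ‖ ^ 2) := by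
    intro x
    have h := (b.hasSum_inner_mul_inner x x).mapL Complex.reCLM
    have e : ∀ i, Complex.reCLM (⟪x, b i⟫_ℂ * ⟪b i, x⟫_ℂ) = ‖⟪b i, x⟫_ℂ‖ ^ 2 := fun i => by
      rw [← inner_conj_symm x, Complex.conj_mul']
      simp [← Complex.ofReal_pow]
    simp only [e] at h
    have e2 : Complex.reCLM ⟪x, x⟫_ℂ = ‖x‖ ^ 2 := inner_self_eq_norm_sq (𝕜 := ℂ) x
    rw [e2] at h
    rw [← h.tsum_eq, ENNReal.ofReal_tsum_of_nonneg (fun _ => by positivity) h.summable]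
  -- Parseval in `b`, exchange of the sums, self-adjointness of `S`, then Bessel's inequality for
  -- `f`.
  calc ∑ j, ENNReal.ofReal (‖S (f j)‖ ^ 2)
      = ∑ j, ∑' i, ENNReal.ofReal (‖⟪b i, S (f j)⟫_ℂ‖ ^ 2) := by simp only [← hparseval]
    _ = ∑' i, ∑ j, ENNReal.ofReal (‖⟪b i, S (f j)⟫_ℂ‖ ^ 2) :=
        (Summable.tsum_finsetSum fun _ _ => ENNReal.summable).symm
    _ ≤ _ := by
        refine ENNReal.tsum_le_tsum fun i => ?_
        rw [← ENNReal.ofReal_sum_of_nonneg fun _ _ => by positivity]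
        refine ENNReal.ofReal_le_ofReal ?_
        have e : ∀ j, ‖⟪b i, S (f j)⟫_ℂ‖ = ‖⟪f j, S (b i)⟫_ℂ‖ := fun j => by
          rw [← ContinuousLinearMap.adjoint_inner_left, ← ContinuousLinearMap.star_eq_adjoint,
            hS.star_eq, norm_inner_symm]
        simp only [e]
        exact hf.sum_inner_products_le (S (b i))

/-- With `T = R²`, the trace of `T ^ m` is the sum of `‖R ^ m b_i‖²`, which dominates the same sum
over `f`; Jensen's inequality bounds each term of the latter below. -/
theorem sum_pow_le_traceIn {n : ℕ} {ι : Type} {κ : Type*} [Fintype κ]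
    (b : HilbertBasis ι ℂ (L2 n)) {T : L2 n →L[ℂ] L2 n} (hT : T.IsPositive) {f : κ → L2 n}
    (hf : Orthonormal ℂ f) (m : ℕ) :
    ENNReal.ofReal (∑ j, (RCLike.re ⟪f j, T (f j)⟫_ℂ) ^ m) ≤ traceIn b (T ^ m) := by
  obtain ⟨R, hR, hRT⟩ := exists_selfAdjoint_sqrt hT
  have key : ∀ x : L2 n, RCLike.re ⟪x, (T ^ m) x⟫_ℂ = ‖(R ^ m) x‖ ^ 2 := fun x => by
    rw [← hRT, ← pow_two, ← pow_mul, inner_pow_two_mul hR, inner_self_eq_norm_sq]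
  unfold traceIn
  simp only [key]
  refine le_trans ?_ (sum_norm_sq_le_tsum b hf (hR.pow m))
  rw [← ENNReal.ofReal_sum_of_nonneg fun _ _ => by positivity]
  refine ENNReal.ofReal_le_ofReal (Finset.sum_le_sum fun j _ => ?_)
  rw [← key]
  exact pow_inner_le_inner_pow hT (hf.1 j) m

end Trace

/-! ### Finite diagonalization and power sums -/

section Diagonalization

variable {H : Type*} [NormedAddCommGroup H] [InnerProductSpace ℂ H]
  {κ : Type*} [Fintype κ]

/-- A positive operator compressed to the span of a finite orthonormal system can be diagonalized by
an orthonormal system; the sum of the diagonal entries and the Hilbert–Schmidt norm are preserved. -/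
theorem exists_orthonormal_diagonal {e : κ → H} (he : Orthonormal ℂ e) {T : H →L[ℂ] H}
    (hT : T.IsPositive) :
    ∃ f : κ → H, Orthonormal ℂ f ∧ (∀ r, f r ∈ Submodule.span ℂ (range e)) ∧
      ∑ r, RCLike.re ⟪f r, T (f r)⟫_ℂ = ∑ r, RCLike.re ⟪e r, T (e r)⟫_ℂ ∧
      ∑ r, (RCLike.re ⟪f r, T (f r)⟫_ℂ) ^ 2 = ∑ i, ∑ j, ‖⟪e i, T (e j)⟫_ℂ‖ ^ 2 := by
  classical
  have hsymm : ∀ x y : H, ⟪T x, y⟫_ℂ = ⟪x, T y⟫_ℂ := hT.isSymmetric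
  let A : Matrix κ κ ℂ := Matrix.of fun i j => ⟪e i, T (e j)⟫_ℂ
  have hA : A.IsHermitian := by
    ext i j
    simp only [A, Matrix.conjTranspose_apply, Matrix.of_apply, RCLike.star_def]
    rw [inner_conj_symm, hsymm]
  let U : Matrix κ κ ℂ := hA.eigenvectorUnitary
  have hU : star U * U = 1 := Unitary.coe_star_mul_self hA.eigenvectorUnitary
  let D : Matrix κ κ ℂ := Matrix.diagonal (RCLike.ofReal ∘ hA.eigenvalues)
  have hD : star U * A * U = D := by
    have := hA.conjStarAlgAut_star_eigenvectorUnitary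
    rwa [Unitary.conjStarAlgAut_star_apply] at this
  have hU' : U * star U = 1 := Unitary.coe_mul_star_self hA.eigenvectorUnitary
  -- Coefficients are taken from the columns of the unitary diagonalizing the compressed matrix `A`.
  -- The two preserved sums are then `tr A` and `tr A²`.
  let f : κ → H := fun r => ∑ i, U i r • e i
  have hfT : ∀ r s, ⟪f r, T (f s)⟫_ℂ = (star U * A * U) r s := by
    intro r s
    simp only [f, map_sum, map_smul, sum_inner, inner_sum, inner_smul_left, inner_smul_right,
      Matrix.mul_apply, Finset.sum_mul, Matrix.star_apply, A, Matrix.of_apply, RCLike.star_def]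
    refine Finset.sum_congr rfl fun i _ => ?_
    rw [Finset.mul_sum]
    refine Finset.sum_congr rfl fun j _ => by ring
  have hfrr : ∀ r, RCLike.re ⟪f r, T (f r)⟫_ℂ = hA.eigenvalues r := by
    intro r
    rw [hfT, hD]
    simp [D]
  refine ⟨f, ?_, fun r => Submodule.sum_mem _ fun i _ => Submodule.smul_mem _ _
    (Submodule.subset_span ⟨i, rfl⟩), ?_, ?_⟩
  · rw [orthonormal_iff_ite]
    intro r s
    have : ⟪f r, f s⟫_ℂ = (star U * U) r s := by
      simp only [f, sum_inner, inner_sum, inner_smul_left, inner_smul_right,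
        Matrix.mul_apply, Matrix.star_apply, RCLike.star_def, orthonormal_iff_ite.1 he]
      refine Finset.sum_congr rfl fun i _ => ?_
      simp [mul_comm]
    rw [this, hU, Matrix.one_apply]
  · simp only [hfrr]
    have h := hA.trace_eq_sum_eigenvalues
    have h2 := congrArg RCLike.re h
    simp only [Matrix.trace, Matrix.diag, map_sum] at h2
    simpa [A] using h2.symm
  · simp only [hfrr]
    have h1 : (A * A).trace = (D * D).trace := by
      rw [← hD]
      have : star U * A * U * (star U * A * U) = star U * (A * A * U) := by
        calc star U * A * U * (star U * A * U) = star U * A * (U * star U) * (A * U) := by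
              simp only [Matrix.mul_assoc]
          _ = star U * (A * A * U) := by rw [hU']; simp only [Matrix.mul_one, Matrix.mul_assoc]
      rw [this, Matrix.trace_mul_comm (star U), Matrix.mul_assoc (A * A), hU', Matrix.mul_one]
    have h2 : (D * D).trace = ((∑ r, hA.eigenvalues r ^ 2 : ℝ) : ℂ) := by
      simp [D, Matrix.trace, pow_two]
    have h3 : (A * A).trace = ((∑ i, ∑ j, ‖⟪e i, T (e j)⟫_ℂ‖ ^ 2 : ℝ) : ℂ) := by
      simp only [Matrix.trace, Matrix.diag, Matrix.mul_apply, A, Matrix.of_apply]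
      push_cast
      refine Finset.sum_congr rfl fun i _ => Finset.sum_congr rfl fun j _ => ?_
      rw [← Complex.mul_conj', inner_conj_symm, hsymm]
    exact_mod_cast (h3.symm.trans (h1.trans h2)).symm

/-- Bernoulli's inequality for `l r / μ`, multiplied by `μ ^ m * l r`, leaves a correction
proportional to `∑ l² / μ - ∑ l`, nonnegative by `h2`. Higher power sums are thus controlled without
knowing the spectrum. -/
theorem mul_sum_le_sum_pow {l : κ → ℝ} (hl : ∀ r, 0 ≤ l r) {μ : ℝ} (hμ : 0 < μ)
    (h2 : μ * ∑ r, l r ≤ ∑ r, l r ^ 2) (m : ℕ) :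
    μ ^ m * ∑ r, l r ≤ ∑ r, l r ^ (m + 1) := by
  have key : ∀ r, μ ^ m * l r + m * μ ^ m * (l r ^ 2 / μ - l r) ≤ l r ^ (m + 1) := by
    intro r
    have h0 : 0 ≤ l r / μ := div_nonneg (hl r) hμ.le
    have := one_add_mul_sub_le_pow (n := m) (by linarith : (-1 : ℝ) ≤ l r / μ)
    rw [div_pow] at this
    have hm : 0 < μ ^ m := pow_pos hμ m
    rw [le_div_iff₀ hm] at this
    calc _ = (1 + m * (l r / μ - 1)) * μ ^ m * l r := by field_simp
      _ ≤ l r ^ m * l r := mul_le_mul_of_nonneg_right this (hl r)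
      _ = _ := by ring
  refine le_trans ?_ (Finset.sum_le_sum fun r _ => key r)
  rw [Finset.sum_add_distrib, ← Finset.mul_sum, ← Finset.mul_sum, Finset.sum_sub_distrib,
    ← Finset.sum_div]
  have : 0 ≤ (∑ r, l r ^ 2) / μ - ∑ r, l r := by
    rw [sub_nonneg, le_div_iff₀ hμ]; linarith
  have h4 : 0 ≤ (m : ℝ) * μ ^ m := by positivity
  nlinarith [mul_nonneg h4 this]

end Diagonalization

/-! ### Binomial identities and estimates -/

section Combinatorics

open Finset

/-- Vandermonde's identity: compare coefficients of `X ^ k` in `∏ (1 + X)^(N j)`. -/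
theorem sum_piAntidiag_prod_choose {ι : Type*} [Fintype ι] [DecidableEq ι] (N : ι → ℕ) (k : ℕ) :
    ∑ b ∈ piAntidiag univ k, ∏ j, (N j).choose (b j) = (∑ j, N j).choose k := by
  have h1 : PowerSeries.coeff k (∏ j, ((1 + Polynomial.X : Polynomial ℕ) ^ N j : PowerSeries ℕ))
      = (∑ j, N j).choose k := by
    have : (∏ j, (((1 + Polynomial.X : Polynomial ℕ) : PowerSeries ℕ) ^ N j))
        = (((1 + Polynomial.X : Polynomial ℕ) ^ (∑ j, N j) : Polynomial ℕ) : PowerSeries ℕ) := by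
      rw [prod_pow_eq_pow_sum, Polynomial.coe_pow]
    rw [this, Polynomial.coeff_coe, Polynomial.coeff_one_add_X_pow, Nat.cast_id]
  rw [← h1, PowerSeries.coeff_prod]
  refine sum_bij' (fun b _ => Finsupp.equivFunOnFinite.symm b) (fun b _ => (b : ι → ℕ)) ?_ ?_ ?_ ?_ ?_
  · intro b hb
    simpa using hb
  · intro b hb
    simpa using hb
  · intro b _; rfl
  · intro b _; ext; rfl
  · intro b _
    refine prod_congr rfl fun j _ => ?_
    rw [← Polynomial.coe_pow, Polynomial.coeff_coe, Polynomial.coeff_one_add_X_pow]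
    rfl

theorem card_piAntidiag_univ (n M : ℕ) (hn : 1 ≤ n) :
    (piAntidiag (univ : Finset (Fin n)) M).card = (M + (n - 1)).choose (n - 1) := by
  rw [← map_sym_eq_piAntidiag, card_map, sym_univ, card_univ, Sym.card_sym_eq_choose, Fintype.card_fin,
    ← Nat.choose_symm_of_eq_add (a := n - 1) (b := M) (by omega)]
  congr 1
  omega

theorem pow_div_factorial_le_card (n M : ℕ) (hn : 1 ≤ n) :
    (M : ℝ) ^ (n - 1) / (n - 1).factorial ≤ (piAntidiag (univ : Finset (Fin n)) M).card := by
  rw [card_piAntidiag_univ n M hn]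
  refine le_trans ?_ (Nat.pow_le_choose (α := ℝ) (n - 1) (M + (n - 1)))
  gcongr
  omega

/-- The bound `centralBinom r ≥ 4^r / (2√r)`, squared to avoid roots; the induction step is `4r(r+1)
≤ (2r+1)²`. -/
theorem sixteen_pow_le (r : ℕ) (hr : 1 ≤ r) : (16 : ℝ) ^ r ≤ (Nat.centralBinom r : ℝ) ^ 2 * (4 * r) := by
  induction r, hr using Nat.le_induction with
  | base => norm_num [Nat.centralBinom, Nat.choose]
  | succ r hr ih =>
    have h : ((r : ℝ) + 1) * Nat.centralBinom (r + 1) = 2 * (2 * r + 1) * Nat.centralBinom r := by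
      exact_mod_cast Nat.succ_mul_centralBinom_succ r
    set B : ℝ := (Nat.centralBinom r : ℝ)
    have hr0 : (0 : ℝ) < r + 1 := by positivity
    have hB : (Nat.centralBinom (r + 1) : ℝ) = 2 * (2 * r + 1) * B / (r + 1) := by
      rw [eq_div_iff hr0.ne']; linarith
    rw [hB, pow_succ]
    push_cast
    rw [div_pow, div_mul_eq_mul_div, le_div_iff₀ (by positivity)]
    calc (16 : ℝ) ^ r * 16 * (r + 1) ^ 2 ≤ B ^ 2 * (4 * r) * 16 * (r + 1) ^ 2 := by gcongr
      _ = (4 * (r * (r + 1))) * (16 * B ^ 2 * (r + 1)) := by ring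
      _ ≤ (2 * r + 1) ^ 2 * (16 * B ^ 2 * (r + 1)) := by gcongr; nlinarith
      _ = _ := by ring

/-- Off-centre coefficients lose at most the factor `1 - i²/r`, so they stay comparable to the
central one for `i` up to order `√r`. -/
theorem sub_sq_mul_centralBinom_le (r i : ℕ) (hi : i ≤ r) :
    ((r : ℝ) - i ^ 2) * Nat.centralBinom r ≤ r * ((2 * r).choose (r - i) : ℝ) := by
  induction i with
  | zero => simp [Nat.centralBinom]
  | succ i ih =>
    have ih := ih (by omega)
    obtain ⟨s, rfl⟩ : ∃ s, r = s + i + 1 := ⟨r - i - 1, by omega⟩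
    have h := Nat.choose_succ_right_eq (2 * (s + i + 1)) s
    rw [show s + i + 1 - i = s + 1 by omega] at ih
    rw [show s + i + 1 - (i + 1) = s by omega]
    rw [show 2 * (s + i + 1) - s = s + 2 * i + 2 by omega] at h
    have h' : ((2 * (s + i + 1)).choose (s + 1) : ℝ) * (s + 1)
        = (2 * (s + i + 1)).choose s * (s + 2 * i + 2) := by exact_mod_cast h
    set B : ℝ := (Nat.centralBinom (s + i + 1) : ℝ)
    have hB : 0 ≤ B := Nat.cast_nonneg _
    set x : ℝ := ((2 * (s + i + 1)).choose (s + 1) : ℝ)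
    set y : ℝ := ((2 * (s + i + 1)).choose s : ℝ)
    push_cast at ih ⊢
    have hp : (0 : ℝ) < s + 2 * i + 2 := by positivity
    refine le_of_mul_le_mul_right ?_ hp
    -- The difference of the first two expressions is exactly `-B (i³ + (i+1)³)`.
    calc ((s : ℝ) + i + 1 - (i + 1) ^ 2) * B * (s + 2 * i + 2)
        ≤ (s + i + 1 - i ^ 2) * B * (s + 1) := by
          have : 0 ≤ B * ((i : ℝ) ^ 3 + (i + 1) ^ 3) := by positivity
          nlinarith
      _ ≤ (s + i + 1) * x * (s + 1) := by gcongr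
      _ = (s + i + 1) * y * (s + 2 * i + 2) := by rw [mul_assoc, h']; ring

theorem inv_sqrt_le_choose (r i : ℕ) (hr : 1 ≤ r) (hi : 2 * i ^ 2 ≤ r) :
    1 / (4 * √(r : ℝ)) ≤ ((2 * r).choose (r - i) : ℝ) / 4 ^ r := by
  have hir : i ≤ r := by nlinarith
  have h1 := sub_sq_mul_centralBinom_le r i hir
  have h2 := sixteen_pow_le r hr
  have hr0 : (0 : ℝ) < r := by exact_mod_cast hr
  have hi' : 2 * (i : ℝ) ^ 2 ≤ r := by exact_mod_cast hi
  set B : ℝ := (Nat.centralBinom r : ℝ)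
  have hB : 0 ≤ B := Nat.cast_nonneg _
  have h3 : B / 2 ≤ ((2 * r).choose (r - i) : ℝ) := by
    refine le_of_mul_le_mul_left (le_trans ?_ h1) hr0
    nlinarith
  have h4 : (4 : ℝ) ^ r ≤ B * (2 * √(r : ℝ)) := by
    refine le_of_sq_le_sq ?_ (by positivity)
    rw [mul_pow, mul_pow, Real.sq_sqrt hr0.le, ← pow_mul, mul_comm r 2, pow_mul]
    norm_num
    linarith
  have hs : 0 < √(r : ℝ) := Real.sqrt_pos.2 hr0
  rw [div_le_div_iff₀ (by positivity) (by positivity)]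
  nlinarith

end Combinatorics

/-! ### Matrix elements of the potential -/

section MatrixElements

variable {n : ℕ}

theorem inner_toL2_potentialMul_toL2 (α β α' β' : Fin n → ℕ) :
    ⟪toL2 (hermS α β), potentialMul n (toL2 (hermS α' β'))⟫_ℂ
      = ∏ j, chInt 1 (β j) (α j) (α' j) (β' j) := by
  have h := integral_conj_hermProd_mul (1 / 2) α β α' β'
  rw [add_halves] at h
  rw [inner_potentialMul, ← h]
  refine integral_congr_ae ?_
  filter_upwards [coeFn_toL2 (hermS α β), coeFn_toL2 (hermS α' β')] with z h1 h2
  rw [h1, h2, hermS_coe, hermS_coe]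
  rfl

theorem inner_hermL2_potentialMul_hermL2 (p p' : (Fin n → ℕ) × (Fin n → ℕ)) :
    ⟪hermL2 p, potentialMul n (hermL2 p')⟫_ℂ = ((hermNorm p.1 p.2)⁻¹ * (hermNorm p'.1 p'.2)⁻¹ : ℝ)
      * ∏ j, chInt 1 (p.2 j) (p.1 j) (p'.1 j) (p'.2 j) := by
  unfold hermL2
  rw [map_smul, inner_smul_left, inner_smul_right, inner_toL2_potentialMul_toL2, map_inv₀,
    Complex.conj_ofReal]
  push_cast
  ring

theorem hermNorm_sq (α β : Fin n → ℕ) :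
    hermNorm α β ^ 2 = ∏ j, (2 * Real.pi * 2 ^ (α j + β j) * (α j).factorial * (β j).factorial) := by
  unfold hermNorm
  rw [← Finset.prod_pow]
  refine Finset.prod_congr rfl fun j _ => Real.sq_sqrt ?_
  have := Real.pi_pos
  positivity

theorem prod_half_mul_choose (N β : Fin n → ℕ) :
    ∏ j, (2⁻¹ * (2⁻¹) ^ N j * ((N j).choose (β j) : ℝ))
      = (2⁻¹) ^ (n + ∑ j, N j) * ((∏ j, (N j).choose (β j) : ℕ) : ℝ) := by
  rw [Finset.prod_mul_distrib, Finset.prod_mul_distrib, Finset.prod_const, Finset.card_univ,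
    Fintype.card_fin, Finset.prod_pow_eq_pow_sum, pow_add, Nat.cast_prod]

theorem cast_add_choose_right (a b : ℕ) :
    ((a + b).choose b : ℝ) = (a + b).factorial / (a.factorial * b.factorial) := by
  rw [← Nat.choose_symm_add, Nat.cast_add_choose]

theorem re_inner_hermL2_self (p : (Fin n → ℕ) × (Fin n → ℕ)) :
    RCLike.re ⟪hermL2 p, potentialMul n (hermL2 p)⟫_ℂ
      = (2⁻¹) ^ (n + ∑ j, (p.1 + p.2) j) * ((∏ j, ((p.1 + p.2) j).choose (p.2 j) : ℕ) : ℝ) := by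
  have h : ⟪hermL2 p, potentialMul n (hermL2 p)⟫_ℂ
      = ((∏ j, (2⁻¹ * (2⁻¹) ^ (p.1 + p.2) j * (((p.1 + p.2) j).choose (p.2 j) : ℝ)) : ℝ) : ℂ) := by
    rw [inner_hermL2_potentialMul_hermL2, ← mul_inv, ← pow_two, hermNorm_sq, ← Finset.prod_inv_distrib,
      Complex.ofReal_prod, ← Finset.prod_mul_distrib, Complex.ofReal_prod]
    refine Finset.prod_congr rfl fun j _ => ?_
    rw [chInt_one, if_pos (add_comm _ _), Pi.add_apply, cast_add_choose_right]
    have hpi : (Real.pi : ℂ) ≠ 0 := by exact_mod_cast Real.pi_ne_zero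
    have h1 : ((p.1 j).factorial : ℂ) ≠ 0 := by exact_mod_cast (p.1 j).factorial_ne_zero
    have h2 : ((p.2 j).factorial : ℂ) ≠ 0 := by exact_mod_cast (p.2 j).factorial_ne_zero
    rw [← two_mul, pow_mul]
    push_cast
    rw [inv_pow]
    field_simp
    simp
  rw [h, prod_half_mul_choose]
  exact Complex.ofReal_re _

/-- Put `N = α' + β = α + β'`. The Gaussian integrals give `N_j!`, and the factorials in the norms
regroup into `N_j!/(α'_j! β_j!)` and `N_j!/(α_j! β'_j!)`. -/
theorem norm_inner_hermL2_sq (p p' : (Fin n → ℕ) × (Fin n → ℕ)) (h : p.2 + p'.1 = p.1 + p'.2) :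
    ‖⟪hermL2 p, potentialMul n (hermL2 p')⟫_ℂ‖ ^ 2
      = ((2⁻¹) ^ (n + ∑ j, (p'.1 + p.2) j)) ^ 2 * ((∏ j, ((p'.1 + p.2) j).choose (p.2 j) : ℕ) : ℝ)
        * ((∏ j, ((p'.1 + p.2) j).choose (p'.2 j) : ℕ) : ℝ) := by
  have e : ∀ j, p.2 j + p'.1 j = p.1 j + p'.2 j := fun j => congrFun h j
  have h1 : ‖⟪hermL2 p, potentialMul n (hermL2 p')⟫_ℂ‖ ^ 2
      = ∏ j, ((2⁻¹ * (2⁻¹) ^ (p'.1 + p.2) j * (((p'.1 + p.2) j).choose (p.2 j) : ℝ))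
        * (2⁻¹ * (2⁻¹) ^ (p'.1 + p.2) j * (((p'.1 + p.2) j).choose (p'.2 j) : ℝ))) := by
    rw [inner_hermL2_potentialMul_hermL2, norm_mul, Complex.norm_real, norm_prod, mul_pow,
      Real.norm_eq_abs, sq_abs, mul_pow, inv_pow, inv_pow, hermNorm_sq, hermNorm_sq,
      ← Finset.prod_inv_distrib, ← Finset.prod_inv_distrib, ← Finset.prod_pow,
      ← Finset.prod_mul_distrib, ← Finset.prod_mul_distrib]
    refine Finset.prod_congr rfl fun j _ => ?_
    have e' : p'.1 j + p.2 j = p.1 j + p'.2 j := by rw [← e j, add_comm]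
    rw [chInt_one, if_pos (e j), norm_mul, norm_mul, norm_pow, norm_neg, norm_one, one_pow, mul_one,
      Complex.norm_real, Complex.norm_natCast, Real.norm_of_nonneg Real.pi_pos.le, Pi.add_apply,
      cast_add_choose_right, e', cast_add_choose_right]
    have h1 : ((p.1 j).factorial : ℝ) ≠ 0 := by exact_mod_cast (p.1 j).factorial_ne_zero
    have h2 : ((p.2 j).factorial : ℝ) ≠ 0 := by exact_mod_cast (p.2 j).factorial_ne_zero
    have h3 : ((p'.1 j).factorial : ℝ) ≠ 0 := by exact_mod_cast (p'.1 j).factorial_ne_zero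
    have h4 : ((p'.2 j).factorial : ℝ) ≠ 0 := by exact_mod_cast (p'.2 j).factorial_ne_zero
    have hpi := Real.pi_ne_zero
    have hpow : (2 : ℝ) ^ (p.1 j + p.2 j) * 2 ^ (p'.1 j + p'.2 j) = (2 ^ (p.1 j + p'.2 j)) ^ 2 := by
      rw [← pow_add, ← pow_mul]
      congr 1
      have := e j
      omega
    rw [← mul_inv]
    calc _ = ((p.1 j + p'.2 j).factorial : ℝ) ^ 2 / (4 * (2 ^ (p.1 j + p.2 j) * 2 ^ (p'.1 j + p'.2 j))
          * (p.1 j).factorial * (p.2 j).factorial * (p'.1 j).factorial * (p'.2 j).factorial) := by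
          field_simp; norm_num
      _ = _ := by
          rw [hpow, inv_pow]; field_simp; norm_num
  rw [h1, Finset.prod_mul_distrib, prod_half_mul_choose, prod_half_mul_choose]
  ring

end MatrixElements

/-! ### Trace and Hilbert–Schmidt norm on a block -/

section Blocks

open Finset

variable {n : ℕ}

/-- The indices of the special Hermite functions with `|α| = l` and `|β| = k`. -/
def block (n k l : ℕ) : Finset ((Fin n → ℕ) × (Fin n → ℕ)) :=
  piAntidiag univ l ×ˢ piAntidiag univ k

theorem mem_block {k l : ℕ} {p : (Fin n → ℕ) × (Fin n → ℕ)} :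
    p ∈ block n k l ↔ ∑ j, p.1 j = l ∧ ∑ j, p.2 j = k := by
  simp [block]

/-- The common diagonal average of the potential on a block. -/
def blockMean (n k l : ℕ) : ℝ := (2⁻¹) ^ (n + (k + l)) * ((k + l).choose k : ℝ)

theorem blockMean_pos (n k l : ℕ) : 0 < blockMean n k l := by
  have : 0 < (k + l).choose k := Nat.choose_pos (Nat.le_add_right _ _)
  unfold blockMean
  positivity

theorem prod_choose_eq_zero {N b : Fin n → ℕ} (h : ¬ b ≤ N) : ∏ j, (N j).choose (b j) = 0 := by
  rw [Pi.le_def] at h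
  push Not at h
  obtain ⟨j, hj⟩ := h
  exact prod_eq_zero (mem_univ j) (Nat.choose_eq_zero_of_lt hj)

/-- Substitute `N = α + β`; for each `N` Vandermonde's identity sums the binomials over `|β| = k`.
Terms with `β ≰ N` vanish, so that constraint can be dropped. -/
theorem sum_block_diagonal (k l : ℕ) :
    ∑ p ∈ block n k l, RCLike.re ⟪hermL2 p, potentialMul n (hermL2 p)⟫_ℂ
      = (piAntidiag (univ : Finset (Fin n)) (k + l)).card * blockMean n k l := by
  classical
  have h1 : ∑ p ∈ block n k l, ∏ j, ((p.1 + p.2) j).choose (p.2 j)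
      = ∑ q ∈ piAntidiag (univ : Finset (Fin n)) (k + l) ×ˢ piAntidiag univ k,
        ∏ j, (q.1 j).choose (q.2 j) := by
    rw [← sum_filter_of_ne (p := fun q : (Fin n → ℕ) × (Fin n → ℕ) => q.2 ≤ q.1)
      (fun q _ hq => by_contra fun hc => hq (prod_choose_eq_zero hc))]
    refine sum_nbij' (fun p => (p.1 + p.2, p.2)) (fun q => (q.1 - q.2, q.2)) ?_ ?_ ?_ ?_ ?_
    · rintro ⟨a, b⟩ h
      rw [mem_block] at h
      simp [sum_add_distrib, h.1, h.2, add_comm k l]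
    · rintro ⟨N, b⟩ h
      simp only [mem_filter, mem_product, mem_piAntidiag] at h
      rw [mem_block]
      obtain ⟨⟨⟨hN, -⟩, hb, -⟩, hle⟩ := h
      refine ⟨?_, hb⟩
      have : ∑ j, (N j - b j) + ∑ j, b j = ∑ j, N j := by
        rw [← sum_add_distrib]
        exact sum_congr rfl fun j _ => Nat.sub_add_cancel (hle j)
      rw [hN, hb] at this
      simp only [Pi.sub_apply]
      omega
    · rintro ⟨a, b⟩ _
      simp
    · rintro ⟨N, b⟩ h
      simp only [mem_filter] at h
      simp [tsub_add_cancel_of_le h.2]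
    · rintro ⟨a, b⟩ _
      rfl
  have h2 : ∀ p ∈ block n k l, RCLike.re ⟪hermL2 p, potentialMul n (hermL2 p)⟫_ℂ
      = (2⁻¹) ^ (n + (k + l)) * ((∏ j, ((p.1 + p.2) j).choose (p.2 j) : ℕ) : ℝ) := by
    intro p hp
    rw [mem_block] at hp
    rw [re_inner_hermL2_self]
    simp only [Pi.add_apply, sum_add_distrib, hp.1, hp.2, add_comm l k]
  rw [sum_congr rfl h2, ← mul_sum, ← Nat.cast_sum, h1, sum_product]
  simp only [sum_piAntidiag_prod_choose]
  rw [sum_congr rfl fun N hN => by rw [(mem_piAntidiag.1 hN).1], sum_const, blockMean]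
  rw [nsmul_eq_mul]
  push_cast
  ring

/-- Only pairs with `β + α' = α + β'` are kept. In the variables `N = α' + β`, `β`, `β'` the sum
over `β` and `β'` factorizes, and Vandermonde's identity applies twice. -/
theorem le_sum_block_sq (k l : ℕ) :
    (piAntidiag (univ : Finset (Fin n)) (k + l)).card * blockMean n k l ^ 2
      ≤ ∑ p ∈ block n k l, ∑ p' ∈ block n k l, ‖⟪hermL2 p, potentialMul n (hermL2 p')⟫_ℂ‖ ^ 2 := by
  classical
  rw [← sum_product']
  refine le_trans ?_ (sum_le_sum_of_subset_of_nonneg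
    (filter_subset (fun x => x.1.2 + x.2.1 = x.1.1 + x.2.2) _) fun _ _ _ => by positivity)
  have h2 : ∀ x ∈ (block n k l ×ˢ block n k l).filter (fun x => x.1.2 + x.2.1 = x.1.1 + x.2.2),
      ‖⟪hermL2 x.1, potentialMul n (hermL2 x.2)⟫_ℂ‖ ^ 2
      = ((2⁻¹) ^ (n + (k + l))) ^ 2 * (((∏ j, ((x.2.1 + x.1.2) j).choose (x.1.2 j))
        * ∏ j, ((x.2.1 + x.1.2) j).choose (x.2.2 j) : ℕ) : ℝ) := by
    intro x hx
    simp only [mem_filter, mem_product, mem_block] at hx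
    rw [norm_inner_hermL2_sq _ _ hx.2]
    simp only [Pi.add_apply, sum_add_distrib, hx.1.1.2, hx.1.2.1, add_comm l k]
    push_cast
    ring
  have h1 : ∑ x ∈ (block n k l ×ˢ block n k l).filter (fun x => x.1.2 + x.2.1 = x.1.1 + x.2.2),
      ((∏ j, ((x.2.1 + x.1.2) j).choose (x.1.2 j)) * ∏ j, ((x.2.1 + x.1.2) j).choose (x.2.2 j))
      = ∑ q ∈ piAntidiag (univ : Finset (Fin n)) (k + l) ×ˢ (piAntidiag univ k ×ˢ piAntidiag univ k),
        (∏ j, (q.1 j).choose (q.2.1 j)) * ∏ j, (q.1 j).choose (q.2.2 j) := by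
    rw [← sum_filter_of_ne (s := _ ×ˢ _)
      (p := fun q : (Fin n → ℕ) × ((Fin n → ℕ) × (Fin n → ℕ)) => q.2.1 ≤ q.1 ∧ q.2.2 ≤ q.1)
      (fun q _ hq => ⟨by_contra fun hc => hq (by rw [prod_choose_eq_zero hc, zero_mul]),
        by_contra fun hc => hq (by rw [prod_choose_eq_zero hc, mul_zero])⟩)]
    refine sum_nbij' (fun x => (x.2.1 + x.1.2, x.1.2, x.2.2))
      (fun q => ((q.1 - q.2.2, q.2.1), (q.1 - q.2.1, q.2.2))) ?_ ?_ ?_ ?_ ?_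
    · rintro ⟨⟨a, b⟩, ⟨a', b'⟩⟩ h
      simp only [mem_filter, mem_product, mem_block] at h
      obtain ⟨⟨⟨ha, hb⟩, ha', hb'⟩, h⟩ := h
      have h' : a' + b = a + b' := by rw [← h, add_comm]
      simp only [mem_filter, mem_product, mem_piAntidiag,
        Pi.add_apply, sum_add_distrib, ha', hb, hb', add_comm l k, true_and]
      exact ⟨by simp, le_add_self, h' ▸ le_add_self⟩
    · rintro ⟨N, b, b'⟩ h
      simp only [mem_filter, mem_product, mem_piAntidiag] at h
      obtain ⟨⟨⟨hN, -⟩, ⟨hb, -⟩, hb', -⟩, hle, hle'⟩ := h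
      simp only [mem_filter, mem_product, mem_block]
      have e : ∀ c : Fin n → ℕ, c ≤ N → ∑ j, (N j - c j) + ∑ j, c j = ∑ j, N j := fun c hc => by
        rw [← sum_add_distrib]
        exact sum_congr rfl fun j _ => Nat.sub_add_cancel (hc j)
      have e1 := e b hle
      have e2 := e b' hle'
      rw [hN, hb] at e1
      rw [hN, hb'] at e2
      refine ⟨⟨⟨?_, hb⟩, ?_, hb'⟩, ?_⟩
      · simp only [Pi.sub_apply]; omega
      · simp only [Pi.sub_apply]; omega
      · rw [add_tsub_cancel_of_le hle, tsub_add_cancel_of_le hle']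
    · rintro ⟨⟨a, b⟩, ⟨a', b'⟩⟩ h
      simp only [mem_filter] at h
      have h' : a' + b = a + b' := by rw [← h.2, add_comm]
      refine Prod.ext (Prod.ext ?_ rfl) (Prod.ext ?_ rfl)
      · simp only; rw [h', add_tsub_cancel_right]
      · simp only; rw [add_tsub_cancel_right]
    · rintro ⟨N, b, b'⟩ h
      simp only [mem_filter] at h
      refine Prod.ext ?_ rfl
      simp only
      exact tsub_add_cancel_of_le h.2.1
    · rintro ⟨⟨a, b⟩, ⟨a', b'⟩⟩ _
      rfl
  rw [sum_congr rfl h2, ← mul_sum, ← Nat.cast_sum, h1, sum_product]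
  simp only [sum_product, ← mul_sum, ← sum_mul, sum_piAntidiag_prod_choose]
  rw [sum_congr rfl fun N hN => by rw [(mem_piAntidiag.1 hN).1], sum_const, blockMean]
  rw [nsmul_eq_mul]
  push_cast
  exact le_of_eq (by ring)

end Blocks

/-! ### Orthonormal systems with divergent power sums -/

section LargeSystems

variable {n : ℕ}

theorem isPositive_potentialMul : (potentialMul n).IsPositive := by
  rw [ContinuousLinearMap.isPositive_iff_complex]
  intro f
  have h : ⟪potentialMul n f, f⟫_ℂ = ((∫ z, potential n z * ‖f z‖ ^ 2 : ℝ) : ℂ) := by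
    rw [← inner_conj_symm, inner_potentialMul_self, Complex.conj_ofReal]
  rw [h]
  refine ⟨by simp, ?_⟩
  rw [RCLike.re_eq_complex_re, Complex.ofReal_re]
  exact integral_nonneg fun z => mul_nonneg (potential_pos z).le (by positivity)

theorem re_inner_potentialMul_nonneg (f : L2 n) : 0 ≤ RCLike.re ⟪f, potentialMul n f⟫_ℂ :=
  isPositive_potentialMul.re_inner_nonneg_right f

theorem exists_block_system (k l : ℕ) :
    ∃ f : block n k l → L2 n, Orthonormal ℂ f ∧
      (∀ r, f r ∈ Submodule.span ℂ (hermL2 '' (block n k l : Set ((Fin n → ℕ) × (Fin n → ℕ))))) ∧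
      ∀ m, (Finset.piAntidiag (Finset.univ : Finset (Fin n)) (k + l)).card * blockMean n k l ^ (m + 1)
        ≤ ∑ r, (RCLike.re ⟪f r, potentialMul n (f r)⟫_ℂ) ^ (m + 1) := by
  obtain ⟨f, hf, hspan, h1, h2⟩ := exists_orthonormal_diagonal
    (orthonormal_hermL2.comp ((↑) : block n k l → _) Subtype.val_injective)
    (isPositive_potentialMul (n := n))
  refine ⟨f, hf, fun r => ?_, fun m => ?_⟩
  · have := hspan r
    rwa [range_comp, Subtype.range_coe_subtype] at this
  · have e1 : ∑ r : block n k l, RCLike.re ⟪hermL2 r.1, potentialMul n (hermL2 r.1)⟫_ℂ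
        = (Finset.piAntidiag (Finset.univ : Finset (Fin n)) (k + l)).card * blockMean n k l := by
      rw [← sum_block_diagonal]
      exact Finset.sum_coe_sort (block n k l)
        fun p => RCLike.re ⟪hermL2 p, potentialMul n (hermL2 p)⟫_ℂ
    have e2 : (Finset.piAntidiag (Finset.univ : Finset (Fin n)) (k + l)).card * blockMean n k l ^ 2
        ≤ ∑ r : block n k l, ∑ s : block n k l,
          ‖⟪hermL2 r.1, potentialMul n (hermL2 s.1)⟫_ℂ‖ ^ 2 := by
      refine (le_sum_block_sq k l).trans_eq ?_
      rw [← Finset.sum_coe_sort]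
      exact Finset.sum_congr rfl fun r _ => (Finset.sum_coe_sort _ _).symm
    have e1' := h1.trans e1
    have e2' := e2.trans_eq h2.symm
    refine le_trans (le_of_eq ?_) (mul_sum_le_sum_pow (fun r => re_inner_potentialMul_nonneg (f r))
      (blockMean_pos n k l) ?_ m)
    · rw [e1']; ring
    · rw [e1']; refine le_trans (le_of_eq ?_) e2'; ring

theorem span_block_le_eigenspace (k l : ℕ) :
    Submodule.span ℂ (hermL2 '' (block n k l : Set ((Fin n → ℕ) × (Fin n → ℕ))))
      ≤ eigenspace n (2 * k + n) := by
  rw [Submodule.span_le]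
  rintro _ ⟨p, hp, rfl⟩
  exact hermL2_mem_eigenspace p (mem_block.1 hp).2

/-- Distinct blocks use disjoint sets of basis vectors, so their diagonalizing systems are mutually
orthogonal. -/
theorem exists_blocks_system (s : Finset (ℕ × ℕ)) (m : ℕ) :
    ∃ (N : ℕ) (f : Fin N → L2 n), Orthonormal ℂ f ∧
      (∀ j, ∃ k : ℕ, f j ∈ eigenspace n (2 * k + n)) ∧
      ∑ b ∈ s, (Finset.piAntidiag (Finset.univ : Finset (Fin n)) (b.1 + b.2)).card
          * blockMean n b.1 b.2 ^ (m + 1)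
        ≤ ∑ j, (RCLike.re ⟪f j, potentialMul n (f j)⟫_ℂ) ^ (m + 1) := by
  classical
  choose f hf hspan hsum using fun b : s => exists_block_system (n := n) b.1.1 b.1.2
  let F : (Σ b : s, block n b.1.1 b.1.2) → L2 n := fun x => f x.1 x.2
  have hF : Orthonormal ℂ F := by
    rw [orthonormal_iff_ite]
    rintro ⟨b, r⟩ ⟨b', r'⟩
    by_cases hb : b = b'
    · subst hb
      simpa using orthonormal_iff_ite.1 (hf b) r r'
    · rw [if_neg fun h => hb (congrArg Sigma.fst h)]
      refine (Submodule.isOrtho_span.2 ?_).inner_eq (hspan b r) (hspan b' r')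
      rintro _ ⟨p, hp, rfl⟩ _ ⟨p', hp', rfl⟩
      refine orthonormal_hermL2.2 fun h => hb ?_
      subst h
      have h1 := mem_block.1 hp
      have h2 := mem_block.1 hp'
      exact Subtype.ext (Prod.ext (h1.2.symm.trans h2.2) (h1.1.symm.trans h2.1))
  refine ⟨_, F ∘ (Fintype.equivFin _).symm, hF.comp _ (Equiv.injective _), fun j => ?_, ?_⟩
  · exact ⟨_, span_block_le_eigenspace _ _ (hspan _ _)⟩
  · have e := (Fintype.equivFin (Σ b : s, block n b.1.1 b.1.2)).symm.sum_comp
      fun x => (RCLike.re ⟪F x, potentialMul n (F x)⟫_ℂ) ^ (m + 1)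
    refine le_trans ?_ e.ge
    rw [Fintype.sum_sigma, ← Finset.sum_coe_sort]
    exact Finset.sum_le_sum fun b _ => hsum b m

/-- At least `√r / 2` values of `i`, each contributing a constant times `r^(n-1) (√r)^(-(2n+1))`,
combine to order `1/r`. -/
theorem inv_le_sum_blocks (hn : 1 ≤ n) (r : ℕ) (hr : 1 ≤ r) :
    ((2⁻¹) ^ n / 4) ^ (2 * n + 1) / (2 * (n - 1).factorial) * (1 / (r : ℝ))
      ≤ ∑ i ∈ Finset.range (Nat.sqrt (r / 2) + 1),
        (Finset.piAntidiag (Finset.univ : Finset (Fin n)) (r - i + (r + i))).card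
          * blockMean n (r - i) (r + i) ^ (2 * n + 1) := by
  have hr0 : (0 : ℝ) < r := by exact_mod_cast hr
  have hs : 0 < √(r : ℝ) := Real.sqrt_pos.2 hr0
  have hss : √(r : ℝ) ^ 2 = r := Real.sq_sqrt hr0.le
  have hterm : ∀ i ∈ Finset.range (Nat.sqrt (r / 2) + 1),
      (r : ℝ) ^ (n - 1) / (n - 1).factorial * ((2⁻¹) ^ n * (1 / (4 * √(r : ℝ)))) ^ (2 * n + 1)
      ≤ (Finset.piAntidiag (Finset.univ : Finset (Fin n)) (r - i + (r + i))).card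
          * blockMean n (r - i) (r + i) ^ (2 * n + 1) := by
    intro i hi
    rw [Finset.mem_range, Nat.lt_succ_iff, Nat.le_sqrt] at hi
    have hi2 : 2 * i ^ 2 ≤ r := by rw [pow_two]; omega
    have hir : i ≤ r := by nlinarith
    have e : r - i + (r + i) = 2 * r := by omega
    unfold blockMean
    rw [e]
    have h1 := pow_div_factorial_le_card n (2 * r) hn
    have h2 := inv_sqrt_le_choose r i hr hi2
    have h3 : (2⁻¹ : ℝ) ^ (n + 2 * r) * ((2 * r).choose (r - i) : ℝ)
        = (2⁻¹) ^ n * (((2 * r).choose (r - i) : ℝ) / 4 ^ r) := by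
      rw [pow_add, pow_mul, div_eq_mul_inv, ← inv_pow]
      norm_num
      ring
    rw [h3]
    refine mul_le_mul (le_trans ?_ h1) ?_ (by positivity) (by positivity)
    · gcongr
      linarith
    · gcongr
  refine le_trans ?_ (Finset.sum_le_sum hterm)
  rw [Finset.sum_const, Finset.card_range, nsmul_eq_mul]
  have hcount : √(r : ℝ) / 2 ≤ ((Nat.sqrt (r / 2) + 1 : ℕ) : ℝ) := by
    have h := Nat.lt_succ_sqrt (r / 2)
    rw [Nat.succ_eq_add_one] at h
    have h' : r ≤ 2 * ((Nat.sqrt (r / 2) + 1) * (Nat.sqrt (r / 2) + 1)) := by omega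
    have h'' : (r : ℝ) ≤ 2 * (((Nat.sqrt (r / 2) + 1 : ℕ) : ℝ) * ((Nat.sqrt (r / 2) + 1 : ℕ) : ℝ)) := by
      exact_mod_cast h'
    refine le_of_sq_le_sq ?_ (Nat.cast_nonneg _)
    rw [div_pow, hss]
    nlinarith
  refine le_trans (le_of_eq ?_) (mul_le_mul_of_nonneg_right hcount (by positivity))
  obtain ⟨m, rfl⟩ : ∃ m, n = m + 1 := ⟨n - 1, by omega⟩
  rw [Nat.add_sub_cancel]
  generalize √(r : ℝ) = x at hs hss ⊢
  rw [← hss]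
  have e : (2⁻¹ : ℝ) ^ (m + 1) * (1 / (4 * x)) = ((2⁻¹) ^ (m + 1) / 4) / x := by
    field_simp
  rw [e, div_pow _ x]
  have e2 : x ^ (2 * (m + 1) + 1) = (x ^ 2) ^ m * x ^ 3 := by
    rw [← pow_mul, ← pow_add]; congr 1
  rw [e2]
  field_simp

/-- Finite orthonormal systems of eigenfunctions on which the potential has large diagonal power
sums. -/
theorem exists_large_system (hn : 1 ≤ n) (R : ℝ) :
    ∃ (N : ℕ) (f : Fin N → L2 n), Orthonormal ℂ f ∧
      (∀ j, ∃ k : ℕ, f j ∈ eigenspace n (2 * k + n)) ∧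
      R ≤ ∑ j, (RCLike.re ⟪f j, potentialMul n (f j)⟫_ℂ) ^ (2 * n + 1) := by
  classical
  set c : ℝ := ((2⁻¹) ^ n / 4) ^ (2 * n + 1) / (2 * (n - 1).factorial) with hc
  have hc0 : 0 < c := by positivity
  -- Divergence of the harmonic series.
  obtain ⟨K, hK⟩ := (Real.tendsto_sum_range_one_div_nat_succ_atTop.eventually_ge_atTop (R / c)).exists
  let S : Finset (Σ _ : ℕ, ℕ) :=
    (Finset.range K).sigma fun r => Finset.range (Nat.sqrt ((r + 1) / 2) + 1)
  let g : (Σ _ : ℕ, ℕ) → ℕ × ℕ := fun x => (x.1 + 1 - x.2, x.1 + 1 + x.2)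
  -- Since `i ≤ r + 1` the subtraction is not truncated, and the sum and difference of the entries
  -- recover `r` and `i`.
  have hg : Set.InjOn g S := by
    rintro ⟨r, i⟩ hx ⟨r', i'⟩ hx' h
    simp only [S, Finset.coe_sigma, Set.mem_sigma_iff, Finset.coe_range, Set.mem_Iio,
      Nat.lt_succ_iff, Nat.le_sqrt] at hx hx'
    have h1 : i ≤ r + 1 := by have := Nat.le_mul_self i; omega
    have h2 : i' ≤ r' + 1 := by have := Nat.le_mul_self i'; omega
    simp only [g, Prod.mk.injEq] at h
    obtain ⟨rfl, rfl⟩ : r = r' ∧ i = i' := by omega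
    rfl
  obtain ⟨N, f, hf, hmem, hsum⟩ := exists_blocks_system (n := n) (S.image g) (2 * n)
  refine ⟨N, f, hf, hmem, le_trans ?_ hsum⟩
  rw [Finset.sum_image hg, Finset.sum_sigma]
  calc R = c * (R / c) := by field_simp
    _ ≤ c * ∑ i ∈ Finset.range K, 1 / ((i : ℝ) + 1) := by gcongr
    _ = ∑ i ∈ Finset.range K, c * (1 / ((i + 1 : ℕ) : ℝ)) := by
      rw [Finset.mul_sum]; push_cast; rfl
    _ ≤ _ := Finset.sum_le_sum fun r _ => inv_le_sum_blocks hn (r + 1) (Nat.le_add_left 1 r)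

end LargeSystems

/-! ### Mixed norms of stationary functions -/

section MixedNorm

variable {n : ℕ} {E : Type*} [NormedAddCommGroup E]

theorem mixedNorm_of_ae_eq {p q : ℝ} (hp : 0 < p) {F : ℝ → (Fin n → ℂ) → E} {G : (Fin n → ℂ) → E}
    (h : ∀ t, F t =ᵐ[volume] G) :
    mixedNorm p q F
      = eLpNorm G (ENNReal.ofReal q) volume * ENNReal.ofReal (2 * Real.pi) ^ (1 / p) := by
  unfold mixedNorm
  simp only [fun t => eLpNorm_congr_ae (p := ENNReal.ofReal q) (h t)]
  rw [setLIntegral_const, Real.volume_Ioo, ENNReal.mul_rpow_of_nonneg _ _ (by positivity),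
    ← ENNReal.rpow_mul, mul_one_div_cancel hp.ne', ENNReal.rpow_one, sub_neg_eq_add, two_mul]

/-- The time interval has length `2π ≥ 1`, so integration in time does not decrease the norm. -/
theorem eLpNorm_le_mixedNorm {p q : ℝ} (hp : 0 < p) {F : ℝ → (Fin n → ℂ) → E} {G : (Fin n → ℂ) → E}
    (h : ∀ t, F t =ᵐ[volume] G) :
    eLpNorm G (ENNReal.ofReal q) volume ≤ mixedNorm p q F := by
  rw [mixedNorm_of_ae_eq hp h]
  refine le_mul_of_one_le_right' ?_
  refine ENNReal.one_le_rpow ?_ (by positivity)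
  rw [← ENNReal.ofReal_one]
  exact ENNReal.ofReal_le_ofReal (by linarith [Real.pi_gt_three])

theorem memLp_potential (n : ℕ) (p : ℝ≥0∞) : MemLp (potential n) p volume :=
  ((gaussN n (1 / 2) one_half_pos).memLp p volume).of_le continuous_potential.aestronglyMeasurable
    (Filter.Eventually.of_forall fun z => by rw [gaussN_half_apply, Complex.norm_real])

theorem mixedNorm_potential_lt_top {p : ℝ} (hp : 0 < p) (q : ℝ) :
    mixedNorm p q (fun _ => potential n) < ⊤ := by
  rw [mixedNorm_of_ae_eq hp fun _ => Filter.EventuallyEq.rfl]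
  exact ENNReal.mul_lt_top (memLp_potential n _).eLpNorm_lt_top
    (ENNReal.rpow_lt_top_of_nonneg (by positivity) ENNReal.ofReal_ne_top)

end MixedNorm

/-! ### Failure of the Strichartz estimate and divergence of the trace -/

section Failure

variable {n : ℕ}

/-- The weighted density of a finite system. -/
def density {N : ℕ} (a : Fin N → ℂ) (f : Fin N → L2 n) (z : Fin n → ℂ) : ℂ :=
  ∑ j, a j * ((‖f j z‖ ^ 2 : ℝ) : ℂ)

theorem aestronglyMeasurable_density {N : ℕ} (a : Fin N → ℂ) (f : Fin N → L2 n) :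
    AEStronglyMeasurable (density a f) volume := by
  unfold density
  refine Finset.aestronglyMeasurable_fun_sum _ fun j _ => ?_
  have := (Lp.aestronglyMeasurable (f j)).norm.pow 2
  exact (Complex.continuous_ofReal.comp_aestronglyMeasurable this).const_mul _

theorem density_propagator_ae_eq {N : ℕ} (a : Fin N → ℂ) {f : Fin N → L2 n}
    (hf : ∀ j, ∃ k : ℕ, f j ∈ eigenspace n (2 * k + n)) (t : ℝ) :
    (fun z => ∑ j, a j * ((‖propagator n t (f j) z‖ ^ 2 : ℝ) : ℂ)) =ᵐ[volume] density a f := by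
  have h : ∀ j, ∀ᵐ z, ‖propagator n t (f j) z‖ = ‖f j z‖ := by
    intro j
    obtain ⟨k, hk⟩ := hf j
    rw [propagator_of_mem hk]
    filter_upwards [Lp.coeFn_smul (Complex.exp (-Complex.I * t * (2 * k + n))) (f j)] with z hz
    rw [hz, Pi.smul_apply, norm_smul, norm_phase, one_mul]
  filter_upwards [ae_all_iff.2 h] with z hz
  simp only [density, hz]

theorem integral_potential_mul_density {N : ℕ} (a : Fin N → ℂ) (f : Fin N → L2 n) :
    ∫ z, potential n z • density a f z
      = ∑ j, a j * (RCLike.re ⟪f j, potentialMul n (f j)⟫_ℂ : ℂ) := by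
  have h : ∀ z, potential n z • density a f z
      = ∑ j, a j * (conj (f j z) * (potential n z : ℂ) * f j z) := by
    intro z
    rw [density, Finset.smul_sum]
    refine Finset.sum_congr rfl fun j _ => ?_
    rw [mul_right_comm (conj _), Complex.conj_mul', Complex.real_smul]
    push_cast
    ring
  simp only [h]
  rw [integral_finsetSum _ fun j _ => (integrable_potential (f j) (f j)).const_mul (a j)]
  refine Finset.sum_congr rfl fun j _ => ?_
  rw [integral_const_mul, ← inner_potentialMul, inner_potentialMul_self]
  simp

theorem holderTriple_ofReal {r q : ℝ} (hr : 0 < r) (hq : 0 < q) (h : 1 / r + 1 / q = 1) :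
    ENNReal.HolderTriple (ENNReal.ofReal r) (ENNReal.ofReal q) 1 := by
  constructor
  rw [← ENNReal.ofReal_inv_of_pos hr, ← ENNReal.ofReal_inv_of_pos hq,
    ← ENNReal.ofReal_add (by positivity) (by positivity)]
  simp only [one_div] at h
  simp [h]

/-- Hölder's inequality between the potential and the density, which does not change in time for
eigenfunctions. -/
theorem ofReal_sum_le_mul_mixedNorm {p q r : ℝ} (hp : 0 < p) (hr : 0 < r) (hq : 0 < q)
    (h : 1 / r + 1 / q = 1) {N : ℕ} (a : Fin N → ℝ) {f : Fin N → L2 n}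
    (hf : ∀ j, ∃ k : ℕ, f j ∈ eigenspace n (2 * k + n)) :
    ENNReal.ofReal (∑ j, a j * RCLike.re ⟪f j, potentialMul n (f j)⟫_ℂ)
      ≤ eLpNorm (potential n) (ENNReal.ofReal r) volume
        * mixedNorm p q (fun t z => ∑ j, (a j : ℂ) * ((‖propagator n t (f j) z‖ ^ 2 : ℝ) : ℂ)) := by
  have hH := holderTriple_ofReal hr hq h
  have h1 := integral_potential_mul_density (fun j => (a j : ℂ)) f
  have h2 : ∫ z, potential n z • density (fun j => (a j : ℂ)) f z
      = ((∑ j, a j * RCLike.re ⟪f j, potentialMul n (f j)⟫_ℂ : ℝ) : ℂ) := by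
    rw [h1]; push_cast; rfl
  calc _ ≤ ‖∫ z, potential n z • density (fun j => (a j : ℂ)) f z‖ₑ := by
        rw [h2, ← ofReal_norm, Complex.norm_real]
        exact ENNReal.ofReal_le_ofReal (le_abs_self _)
    _ ≤ eLpNorm (potential n • density (fun j => (a j : ℂ)) f) 1 volume := by
        rw [eLpNorm_one_eq_lintegral_enorm]
        exact enorm_integral_le_lintegral_enorm _
    _ ≤ _ := eLpNorm_smul_le_mul_eLpNorm (aestronglyMeasurable_density _ f)
        continuous_potential.aestronglyMeasurable
    _ ≤ _ := by
        gcongr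
        exact eLpNorm_le_mixedNorm hp fun t => density_propagator_ae_eq _ hf t

theorem not_orthonormalStrichartz (hn : 1 ≤ n) :
    ¬ OrthonormalStrichartz n ((2 * n + 1) / (2 * n)) ((2 * n + 1) / (2 * n - 1))
      ((2 * n + 1) / (2 * n)) := by
  rintro ⟨C, hC⟩
  have hn1 : (1 : ℝ) ≤ n := by exact_mod_cast hn
  have hn2 : (0 : ℝ) < 2 * n - 1 := by linarith
  set W := (eLpNorm (potential n) (ENNReal.ofReal ((2 * n + 1) / 2)) volume).toReal with hW
  have hWtop := (memLp_potential n (ENNReal.ofReal ((2 * n + 1) / 2))).eLpNorm_ne_top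
  have hW0 : 0 ≤ W := ENNReal.toReal_nonneg
  set D := W * |C| with hD
  have hD0 : 0 ≤ D := by positivity
  obtain ⟨N, f, hf, hmem, hbig⟩ := exists_large_system hn (D ^ (2 * n + 1) + 1)
  set l : Fin N → ℝ := fun j => RCLike.re ⟪f j, potentialMul n (f j)⟫_ℂ with hl
  have hl0 : ∀ j, 0 ≤ l j := fun j => re_inner_potentialMul_nonneg (f j)
  set S := ∑ j, l j ^ (2 * n + 1) with hS
  have hS0 : 0 < S := lt_of_lt_of_le (by positivity) hbig
  have h1 := ofReal_sum_le_mul_mixedNorm (n := n) (p := (2 * n + 1) / (2 * n))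
    (q := (2 * n + 1) / (2 * n - 1)) (r := (2 * n + 1) / 2) (by positivity) (by positivity)
    (by positivity) (by field_simp; ring) (fun j => l j ^ (2 * n)) hmem
  -- The weights `λ_j^(2n)` make both `∑ n_j λ_j` and `∑ |n_j|^β` equal to `S`, since `2n β = 2n +
  -- 1`.
  have h2 := hC N f hf (fun j => ((l j ^ (2 * n) : ℝ) : ℂ))
  have e1 : ∑ j, l j ^ (2 * n) * RCLike.re ⟪f j, potentialMul n (f j)⟫_ℂ = S :=
    Finset.sum_congr rfl fun j _ => (pow_succ _ _).symm
  have e2 : ∑ j, ‖((l j ^ (2 * n) : ℝ) : ℂ)‖ ^ ((2 * n + 1) / (2 * n) : ℝ) = S := by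
    refine Finset.sum_congr rfl fun j _ => ?_
    rw [Complex.norm_real, Real.norm_of_nonneg (pow_nonneg (hl0 j) _), ← Real.rpow_natCast,
      ← Real.rpow_mul (hl0 j), ← Real.rpow_natCast]
    congr 1
    push_cast
    field_simp
  rw [e1] at h1
  rw [e2] at h2
  have h3 : S ≤ D * S ^ (1 / ((2 * n + 1) / (2 * n)) : ℝ) := by
    have h4 := h1.trans (mul_le_mul_right h2 _)
    rw [← ENNReal.ofReal_toReal hWtop, ← ENNReal.ofReal_mul hW0] at h4
    have h5 : W * (C * S ^ (1 / ((2 * n + 1) / (2 * n)) : ℝ))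
        ≤ D * S ^ (1 / ((2 * n + 1) / (2 * n)) : ℝ) := by
      rw [hD, mul_assoc]
      gcongr
      exact le_abs_self C
    exact (ENNReal.ofReal_le_ofReal_iff (by positivity)).1
      (h4.trans (ENNReal.ofReal_le_ofReal h5))
  -- With `S = x^(2n+1)` the estimate reads `x^(2n+1) ≤ D x^(2n)`, so `S ≤ D^(2n+1)`, contradicting
  -- the choice of the system.
  set x := S ^ (1 / (2 * n + 1) : ℝ) with hx
  have hx0 : 0 < x := Real.rpow_pos_of_pos hS0 _
  have hxS : x ^ (2 * n + 1) = S := by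
    rw [hx, ← Real.rpow_natCast, ← Real.rpow_mul hS0.le]
    push_cast
    rw [one_div_mul_cancel (by positivity), Real.rpow_one]
  have hxS' : S ^ (1 / ((2 * n + 1) / (2 * n)) : ℝ) = x ^ (2 * n) := by
    rw [hx, ← Real.rpow_natCast, ← Real.rpow_mul hS0.le]
    congr 1
    push_cast
    field_simp
  rw [hxS', ← hxS, pow_succ, mul_comm] at h3
  have h6 : x ≤ D := le_of_mul_le_mul_right h3 (pow_pos hx0 _)
  have h7 : S ≤ D ^ (2 * n + 1) := by rw [← hxS]; gcongr
  linarith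

theorem traceIn_timeAverage_pow (hn : 1 ≤ n) {ι : Type} (b : HilbertBasis ι ℂ (L2 n)) :
    traceIn b (timeAverage n ^ (2 * n + 1)) = ⊤ := by
  refine ENNReal.eq_top_of_forall_nnreal_le fun R => ?_
  obtain ⟨N, f, hf, hmem, hbig⟩ := exists_large_system hn (R : ℝ)
  refine le_trans ?_ (sum_pow_le_traceIn b isPositive_timeAverage hf (2 * n + 1))
  rw [← ENNReal.ofReal_coe_nnreal]
  refine ENNReal.ofReal_le_ofReal (hbig.trans (Finset.sum_le_sum fun j _ => ?_))
  obtain ⟨k, hk⟩ := hmem j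
  have h0 := re_inner_potentialMul_nonneg (f j)
  refine pow_le_pow_left₀ h0 ?_ _
  have : (2 * Real.pi * ⟪f j, potentialMul n (f j)⟫_ℂ : ℂ)
      = ((2 * Real.pi : ℝ) : ℂ) * ⟪f j, potentialMul n (f j)⟫_ℂ := by push_cast; rfl
  rw [inner_timeAverage_of_mem hk, this, RCLike.re_eq_complex_re, Complex.re_ofReal_mul]
  rw [RCLike.re_eq_complex_re] at h0
  exact le_mul_of_one_le_left h0 (by linarith [Real.pi_gt_three])

theorem not_potential_ae_zero :
    ¬ (∀ᵐ _t ∂(volume.restrict (Ioo (-Real.pi) Real.pi)), potential n =ᵐ[volume] 0) := by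
  have hμ : volume.restrict (Ioo (-Real.pi) Real.pi) ≠ 0 := by
    rw [Ne, Measure.restrict_eq_zero, Real.volume_Ioo, ENNReal.ofReal_eq_zero, not_le]
    linarith [Real.pi_pos]
  have : (ae (volume.restrict (Ioo (-Real.pi) Real.pi))).NeBot := ae_neBot.2 hμ
  rw [Filter.eventually_const]
  intro h
  obtain ⟨z, hz⟩ := h.exists
  exact (potential_pos z).ne' hz

end Failure

end SpecialHermite

end

theorem theorem1p6 (n : ℕ) (hn : 1 ≤ n) :
    (∀ p q β : ℝ, q = (2 * n + 1) / (2 * n - 1) → 1 / p + n / q = n → β = 2 * q / (q + 1) →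
      ¬ SpecialHermite.OrthonormalStrichartz n p q β) ∧
    ∃ (V : ℝ → (Fin n → ℂ) → ℝ) (B : SpecialHermite.L2 n →L[ℂ] SpecialHermite.L2 n),
      Measurable (Function.uncurry V) ∧
      (∀ t z, 0 ≤ V t z) ∧
      ¬ (∀ᵐ t ∂(volume.restrict (Ioo (-Real.pi) Real.pi)), V t =ᵐ[volume] 0) ∧
      SpecialHermite.mixedNorm (2 * n + 1) ((2 * n + 1) / 2) V < ⊤ ∧
      SpecialHermite.IsTimeAverage V B ∧
      B.IsPositive ∧
      ∀ (ι : Type) (b : HilbertBasis ι ℂ (SpecialHermite.L2 n)),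
        SpecialHermite.traceIn b (B ^ (2 * n + 1)) = ⊤ := by
  have hn1 : (1 : ℝ) ≤ n := by exact_mod_cast hn
  have hn2 : (0 : ℝ) < 2 * n - 1 := by linarith
  refine ⟨?_, fun _ => SpecialHermite.potential n, SpecialHermite.timeAverage n,
    SpecialHermite.continuous_potential.measurable.comp measurable_snd,
    fun _ z => (SpecialHermite.potential_pos z).le, SpecialHermite.not_potential_ae_zero,
    SpecialHermite.mixedNorm_potential_lt_top (by positivity) _,
    SpecialHermite.isTimeAverage_timeAverage, SpecialHermite.isPositive_timeAverage,
    fun ι b => SpecialHermite.traceIn_timeAverage_pow hn b⟩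
  intro p q β hq hp hβ
  -- The scaling relation gives `1/p = n - n/q = 2n/(2n+1)`, so `p` and `β` coincide.
  have hp' : p = (2 * n + 1) / (2 * n) := by
    have e : (n : ℝ) / q = n * (2 * n - 1) / (2 * n + 1) := by rw [hq]; field_simp
    have e2 : 1 / p = 2 * n / (2 * n + 1) := by
      rw [e] at hp
      rw [eq_sub_of_add_eq hp]
      field_simp
      ring
    rw [← one_div_one_div p, e2, one_div_div]
  have hβ' : β = (2 * n + 1) / (2 * n) := by
    rw [hβ, hq]
    have : (2 * (n : ℝ) + 1) / (2 * n - 1) + 1 = 4 * n / (2 * n - 1) := by field_simp; ring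
    rw [this]
    field_simp
    ring
  rw [hp', hq, hβ']
  exact SpecialHermite.not_orthonormalStrichartz hn
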